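/- Let $\mathsf h=L^2(\mathbb R;\mathbb C)$, let $q$ be multiplication by $x$ on its maximal domain and $p=-i\,\frac{d}{dx}$ on $H^1(\mathbb R)$, so that $[q,p]=i$. Products of operators carry their natural domains, and sums carry the intersection of the domains. Let $N=\frac12(p^2+q^2-1)$ be the number operator, with domain $\mathrm{Dom}(N)=\{u\in\mathsf h : p^2u,\,q^2u\in\mathsf h\}$. Let $\omega>0$ and let $\gamma,D_{pp},D_{pq},D_{qq}$ be real numbers with $D_{pp},D_{qq}\ge 0$ and $$D_{pp}D_{qq}-D_{pq}^2-\gamma^2/4\ge 0 .$$ Let $V:\mathbb R\to\mathbb R$ be twice differentiable with $|V'(x)|\le g_V(1+|x|^2)^{\alpha/2}$ for all $x\in\mathbb R$, where $g_V>0$ and $0\le\alpha<1$. Consider the expression $$G=-\Big(D_{qq}+\frac i2\Big)p^2-\Big(D_{pp}+\frac{i\omega^2}{2}\Big)q^2+\Big(D_{pq}-\frac{i\gamma}{2}\Big)(pq+qp)+\frac\gamma2-iV(q).$$ **Proposition.** The natural domain of this expression is $\mathrm{Dom}(N)$, which is dense, and the operator so defined is closable; denote its closure again by $G$, and the adjoint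 of $G$ by $G^*$. Then $$\mathrm{Dom}(G)=\mathrm{Dom}(G^*)=\mathrm{Dom}(N),$$ and on this common domain the graph norms of $G$, of $G^*$ and of $N$ are equivalent. Moreover, let $r,s>0$ with $rs>1$, and let $X$ be the self-adjoint operator $rp^2+(pq+qp)+sq^2$ having $C_c^\infty(\mathbb R)$ as a core, that is, the closure of this expression on $C_c^\infty(\mathbb R)$. Then $\mathrm{Dom}(X)=\mathrm{Dom}(G)$, the graph norms of $X$ and $G$ are equivalent, and $G$ is relatively bounded with respect to $X$: there are $a,b\ge0$ with $\|Gu\|\le a\|Xu\|+b\|u\|$ for all $u\in\mathrm{Dom}(X)$. -/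

import Mathlib

open MeasureTheory
open scoped LinearPMap

noncomputable section

namespace QFP

/-- The Hilbert space `L²(ℝ; ℂ)`. -/
abbrev H : Type := Lp ℂ 2 (volume : Measure ℝ)

/-- Partially defined (unbounded) linear operators on `L²(ℝ; ℂ)`. -/
abbrev Op : Type := H →ₗ.[ℂ] H

/-- Complex-valued test functions, `C_c^∞(ℝ)`. -/
def IsTest (φ : ℝ → ℂ) : Prop := ContDiff ℝ (⊤ : ℕ∞) φ ∧ HasCompactSupport φ

theorem IsTest.deriv {φ : ℝ → ℂ} (h : IsTest φ) : IsTest (deriv φ) :=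
  ⟨((contDiff_infty_iff_deriv (𝕜 := ℝ)).1 h.1).2, h.2.deriv⟩

theorem integrable_mul_test (u : H) {φ : ℝ → ℂ} (h : IsTest φ) :
    Integrable (fun x => u x * φ x) volume :=
  MemLp.integrable_mul (p := 2) (q := 2) (Lp.memLp u)
    (h.1.continuous.memLp_of_hasCompactSupport h.2)

/-- `C_c^∞(ℝ)` as a subspace of `L²(ℝ; ℂ)`. -/
def testSubmodule : Submodule ℂ H where
  carrier := {u | ∃ φ : ℝ → ℂ, IsTest φ ∧ (u : ℝ → ℂ) =ᵐ[volume] φ}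
  zero_mem' := ⟨fun _ => 0, ⟨contDiff_const, HasCompactSupport.zero⟩, Lp.coeFn_zero _ _ _⟩
  add_mem' := by
    rintro u v ⟨φ, hφ, hu⟩ ⟨ψ, hψ, hv⟩
    exact ⟨φ + ψ, ⟨hφ.1.add hψ.1, hφ.2.add hψ.2⟩, (Lp.coeFn_add u v).trans (hu.add hv)⟩
  smul_mem' := by
    rintro c u ⟨φ, hφ, hu⟩
    exact ⟨c • φ, ⟨contDiff_const.smul hφ.1, hφ.2.smul_left (f := fun _ => c)⟩,
      (Lp.coeFn_smul c u).trans (hu.const_smul c)⟩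

/-- Multiplication by a real function `f`, on its maximal domain `{u ∈ L² | f u ∈ L²}`. -/
def mulOp (f : ℝ → ℝ) : Op where
  domain :=
    { carrier := {u | MemLp (fun x => (f x : ℂ) * u x) 2 volume}
      zero_mem' := by
        refine (MemLp.zero' (p := 2) (μ := (volume : Measure ℝ)) (ε := ℂ)).ae_eq ?_
        exact Filter.Eventually.of_forall fun x => by
          simp
      add_mem' := by
        intro u v hu hv
        refine (MemLp.add hu hv).ae_eq ?_
        filter_upwards [Lp.coeFn_add u v] with x hx
        exact (mul_add _ _ _).symm.trans (congrArg _ hx.symm)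
      smul_mem' := by
        intro c u hu
        refine (MemLp.const_smul hu c).ae_eq ?_
        filter_upwards [Lp.coeFn_smul c u] with x hx
        exact (mul_left_comm _ _ _).trans (congrArg _ hx.symm) }
  toFun :=
    { toFun := fun u => MemLp.toLp (fun x => (f x : ℂ) * (u : H) x) u.2
      map_add' := by
        intro u v
        rw [← MemLp.toLp_add]
        refine MemLp.toLp_congr _ _ ?_
        filter_upwards [Lp.coeFn_add (u : H) (v : H)] with x hx
        exact (congrArg _ hx).trans (mul_add _ _ _)
      map_smul' := by
        intro c u
        rw [RingHom.id_apply, ← MemLp.toLp_const_smul]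
        refine MemLp.toLp_congr _ _ ?_
        filter_upwards [Lp.coeFn_smul c (u : H)] with x hx
        exact (congrArg _ hx).trans (mul_left_comm _ _ _) }

/-- The graph of the momentum operator `p = -i d/dx` with the weak derivative: the pairs `(u, w)`
in `L² × L²` with `∫ w φ = i ∫ u φ'` for all test functions `φ`. -/
def momentumGraph : Submodule ℂ (H × H) where
  carrier := {z | ∀ φ : ℝ → ℂ, IsTest φ →
    ∫ x, z.2 x * φ x = Complex.I * ∫ x, z.1 x * deriv φ x}
  zero_mem' := by
    intro φ _
    have h1 : ∫ x, (0 : H) x * φ x = 0 := by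
      rw [← integral_zero ℝ ℂ]
      refine integral_congr_ae ?_
      exact Filter.Eventually.of_forall fun x => by
        simp
    have h2 : ∫ x, (0 : H) x * deriv φ x = 0 := by
      rw [← integral_zero ℝ ℂ]
      refine integral_congr_ae ?_
      exact Filter.Eventually.of_forall fun x => by
        simp
    simp only [Prod.fst_zero, Prod.snd_zero]
    rw [h1, h2, mul_zero]
  add_mem' := by
    intro a b ha hb φ hφ
    have key : ∀ (u v : H) (ψ : ℝ → ℂ), IsTest ψ →
        ∫ x, (u + v : H) x * ψ x = (∫ x, u x * ψ x) + ∫ x, v x * ψ x := by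
      intro u v ψ hψ
      rw [← integral_add (integrable_mul_test u hψ) (integrable_mul_test v hψ)]
      refine integral_congr_ae ?_
      filter_upwards [Lp.coeFn_add u v] with x hx
      exact (congrArg (· * ψ x) hx).trans (add_mul _ _ _)
    simp only [Prod.fst_add, Prod.snd_add]
    rw [key _ _ _ hφ, key _ _ _ hφ.deriv, ha φ hφ, hb φ hφ, mul_add]
  smul_mem' := by
    intro c a ha φ hφ
    have key : ∀ (u : H) (ψ : ℝ → ℂ),
        ∫ x, (c • u : H) x * ψ x = c * ∫ x, u x * ψ x := by
      intro u ψ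
      rw [← integral_const_mul]
      refine integral_congr_ae ?_
      filter_upwards [Lp.coeFn_smul c u] with x hx
      exact (congrArg (· * ψ x) hx).trans (mul_assoc _ _ _)
    simp only [Prod.smul_fst, Prod.smul_snd]
    rw [key, key, ha φ hφ, mul_left_comm]

/-- Weak derivatives are unique, so `momentumGraph` is the graph of an operator. -/
theorem momentumGraph_snd_eq_zero (z : H × H) (hz : z ∈ momentumGraph) (h0 : z.1 = 0) :
    z.2 = 0 := by
  have hint : ∀ φ : ℝ → ℂ, IsTest φ → ∫ x, z.2 x * φ x = 0 := by
    intro φ hφ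
    have h2 : ∫ x, z.1 x * deriv φ x = 0 := by
      rw [h0, ← integral_zero ℝ ℂ]
      refine integral_congr_ae ?_
      exact Filter.Eventually.of_forall fun x => by
        simp
    rw [hz φ hφ, h2, mul_zero]
  rw [Lp.eq_zero_iff_ae_eq_zero]
  refine ae_eq_zero_of_integral_contDiff_smul_eq_zero
    ((Lp.memLp z.2).locallyIntegrable (by norm_num)) ?_
  intro g hg hgc
  have h := hint (fun x => (g x : ℂ))
    ⟨Complex.ofRealCLM.contDiff.comp hg, hgc.comp_left (g := Complex.ofReal) (by simp)⟩
  rw [← h]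
  refine integral_congr_ae (Filter.Eventually.of_forall fun x => ?_)
  simp [mul_comm]

/-- The position operator `q`: multiplication by `x`. -/
def q : Op := mulOp (fun x => x)

/-- The momentum operator `p = -i d/dx`, with domain `H¹(ℝ)`. -/
def p : Op := momentumGraph.toLinearPMap

theorem graph_p : p.graph = momentumGraph :=
  Submodule.toLinearPMap_graph_eq _ momentumGraph_snd_eq_zero

/-- The operator product `S T`, with its natural domain `{u ∈ Dom T | T u ∈ Dom S}`. -/
def prodOp (S T : Op) : Op where
  domain := (S.domain.comap T.toFun).map T.domain.subtype
  toFun :=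
    { toFun := fun u => S ⟨T ⟨u, by
          obtain ⟨v, -, hv⟩ := u.2
          exact hv ▸ v.2⟩, by
          obtain ⟨_, v, hv, rfl⟩ := u
          exact hv⟩
      map_add' := by
        intro u v
        rw [← LinearPMap.map_add]
        congr 1
        exact Subtype.ext (T.map_add ⟨u, _⟩ ⟨v, _⟩)
      map_smul' := by
        intro c u
        rw [RingHom.id_apply, ← LinearPMap.map_smul]
        congr 1
        exact Subtype.ext (T.map_smul c ⟨u, _⟩) }

theorem mem_prodOp_domain {S T : Op} {u : H} :
    u ∈ (prodOp S T).domain ↔ ∃ h : u ∈ T.domain, T ⟨u, h⟩ ∈ S.domain := by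
  constructor
  · rintro ⟨v, hv, rfl⟩
    exact ⟨v.2, hv⟩
  · rintro ⟨h, h'⟩
    exact ⟨⟨u, h⟩, h', rfl⟩

/-- The identity operator. -/
def idOp : Op := (LinearMap.id : H →ₗ[ℂ] H).toPMap ⊤

/-- `p² = p p`. -/
def pSq : Op := prodOp p p

/-- `q² = q q`. -/
def qSq : Op := prodOp q q

/-- `pq + qp`. -/
def pqqp : Op := prodOp p q + prodOp q p

/-- The number operator `N = ½(p² + q² - 1)`, with domain `{u | p²u, q²u ∈ L²}`
(sums of operators carry the intersection of the domains). -/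
def numberOp : Op := (1 / 2 : ℂ) • (pSq + qSq - idOp)

/-- The operator given by the expression
`-(D_qq + i/2) p² - (D_pp + iω²/2) q² + (D_pq - iγ/2)(pq + qp) + γ/2 - i V(q)`
on the natural domain of this expression. -/
def generator (ω γ Dpp Dpq Dqq : ℝ) (V : ℝ → ℝ) : Op :=
  (-((Dqq : ℂ) + Complex.I / 2)) • pSq
    + (-((Dpp : ℂ) + Complex.I * (ω : ℂ) ^ 2 / 2)) • qSq
    + ((Dpq : ℂ) - Complex.I * (γ : ℂ) / 2) • pqqp
    + ((γ : ℂ) / 2) • idOp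
    + (-Complex.I) • mulOp V

/-- The self-adjoint operator `X = r p² + (pq + qp) + s q²` (for `r, s > 0`, `r s > 1`), having
`C_c^∞(ℝ)` as a core: the closure of this expression on `C_c^∞(ℝ)`. -/
def quadX (r s : ℝ) : Op :=
  (((r : ℂ) • pSq + pqqp + (s : ℂ) • qSq).domRestrict testSubmodule).closure

/-- The graph norm `(‖T u‖² + ‖u‖²)^{1/2}` on the domain of `T`. -/
def graphNorm (T : Op) (u : T.domain) : ℝ := Real.sqrt (‖T u‖ ^ 2 + ‖(u : H)‖ ^ 2)

/-- `S` and `T` have the same domain, and their graph norms are equivalent on it. -/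
def EquivGraphNorms (S T : Op) : Prop :=
  S.domain = T.domain ∧
    ∃ c C : ℝ, 0 < c ∧ 0 < C ∧ ∀ (u : S.domain) (v : T.domain), (u : H) = v →
      c * graphNorm S u ≤ graphNorm T v ∧ graphNorm T v ≤ C * graphNorm S u

/-- `T` is relatively bounded with respect to `S`: `Dom S ⊆ Dom T` and
`‖T u‖ ≤ a ‖S u‖ + b ‖u‖` on `Dom S`. -/
def RelativelyBounded (T S : Op) : Prop :=
  S.domain ≤ T.domain ∧
    ∃ a b : ℝ, 0 ≤ a ∧ 0 ≤ b ∧ ∀ (u : S.domain) (v : T.domain), (u : H) = v →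
      ‖T v‖ ≤ a * ‖S u‖ + b * ‖(u : H)‖

end QFP

end

noncomputable section

namespace QFP

open Complex ComplexConjugate Filter Topology

local notation "⟪" x ", " y "⟫" => inner ℂ x y

/-! ### Commutator identities and a Gårding inequality for a symmetric canonical pair -/

section CanonicalPair

variable {E : Type*} [NormedAddCommGroup E] [InnerProductSpace ℂ E]

/-! Up to a unimodular factor `κ`, the quadratic part of `G` is elliptic: its symbol, multiplied by
`κ`, has positive definite real part. If `γ ≠ 0` the Lindblad condition makes the dissipative part
definite and `κ = -1` works; if `γ = 0`, `κ = i` turns the Hamiltonian part into the definite form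
(`exists_rotation_elliptic`). All other claims hold for any such elliptic operator plus a
perturbation of relative bound zero, and the potential is one because `V = o(x²)`.

The analytic core is the inequality `exists_re_inner_harmonic_quadMap_ge`. The real part of the
symbol is `ε(ξ² + x²)` plus squares of linear forms. Since linear combinations of `P` and `Q` have
scalar commutators, pairing `P² + Q²` with such a square is nonnegative up to a multiple of `‖x‖²`;
the imaginary part of the symbol contributes only a commutator, which is of second order. Hence `κG
+ μ` is coercive against `H = p² + q² + 1` for large real `μ` (`exists_coercive`).

Coercivity gives the graph norm estimates, and Lax-Milgram applied to `(κG + μ)H⁻¹` gives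
surjectivity (`surjective_of_coercive`). The formal adjoint has conjugate coefficients and is
elliptic for `conj κ`. When shifts of both operators are onto, each is the full adjoint of the other
(`adjoint_eq_of_surjective`), so both are closed on `Dom N`.

The identities are proved on test functions and carried to `Dom N` by density in graph norm
(`dom_induction`). This rests on `H` having dense range on test functions: a vector orthogonal to
the range is `exp(x²/2)(c + k erf)`, which is not square integrable unless it vanishes
(`eq_zero_of_forall_inner_testN_eq_zero`). -/

theorem inner_self_eq_norm_sq_complex (x : E) : ⟪x, x⟫ = ((‖x‖ ^ 2 : ℝ) : ℂ) := by
  rw [inner_self_eq_norm_sq_to_K]; norm_cast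

/-- By symmetry `⟪Lx, Mx⟫ - ⟪Mx, Lx⟫` is the expectation of the commutator, and it also equals `-2i`
times the imaginary part sought. -/
theorem im_inner_of_commutator {L M : E →ₗ[ℂ] E} (hL : L.IsSymmetric) (hM : M.IsSymmetric)
    {k : ℝ} (h : ∀ x, L (M x) - M (L x) = (k * I : ℂ) • x) (x : E) :
    (⟪M x, L x⟫).im = -(k * ‖x‖ ^ 2) / 2 := by
  have h1 : ⟪M x, L x⟫ = ⟪x, M (L x)⟫ := hM x (L x)
  have h2 : ⟪L x, M x⟫ = ⟪x, L (M x)⟫ := hL x (M x)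
  have h3 : ⟪L x, M x⟫ - ⟪M x, L x⟫ = (k * I : ℂ) * ((‖x‖ ^ 2 : ℝ) : ℂ) := by
    rw [h1, h2, ← inner_sub_right, h, inner_smul_right, inner_self_eq_norm_sq_complex]
  rw [← inner_conj_symm] at h3
  have h4 := congrArg Complex.im h3
  rw [sub_im, conj_im] at h4
  simp [-ofReal_pow] at h4
  linarith

/-- One `M` is moved across and commuted past both factors `L`, each passage costing `k i`; then one
`L` is moved back. -/
theorem inner_sq_sq_of_commutator {L M : E →ₗ[ℂ] E} (hL : L.IsSymmetric) (hM : M.IsSymmetric)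
    {k : ℝ} (h : ∀ x, L (M x) - M (L x) = (k * I : ℂ) • x) (x : E) :
    ⟪M (M x), L (L x)⟫ = ((‖L (M x)‖ ^ 2 : ℝ) : ℂ) - 2 * (k * I) * ⟪M x, L x⟫ := by
  have h1 : ∀ y, M (L y) = L (M y) - (k * I : ℂ) • y := fun y => by rw [← h y]; abel
  have h2 : M (L (L x)) = L (L (M x)) - (2 * (k * I) : ℂ) • L x := by
    rw [h1, h1, map_sub, map_smul]; module
  rw [hM, h2, inner_sub_right, inner_smul_right, ← hL, inner_self_eq_norm_sq_complex]

/-- The source of all positivity: a scalar commutator makes the pairing of two squares nonnegative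
up to an error of order zero. -/
theorem re_inner_sq_sq_of_commutator {L M : E →ₗ[ℂ] E} (hL : L.IsSymmetric) (hM : M.IsSymmetric)
    {k : ℝ} (h : ∀ x, L (M x) - M (L x) = (k * I : ℂ) • x) (x : E) :
    (⟪M (M x), L (L x)⟫).re = ‖L (M x)‖ ^ 2 - k ^ 2 * ‖x‖ ^ 2 := by
  have h1 := im_inner_of_commutator hL hM h x
  rw [inner_sq_sq_of_commutator hL hM h]
  simp [-ofReal_pow]
  rw [h1]; ring

theorem im_inner_sq_sq_of_commutator {L M : E →ₗ[ℂ] E} (hL : L.IsSymmetric) (hM : M.IsSymmetric)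
    {k : ℝ} (h : ∀ x, L (M x) - M (L x) = (k * I : ℂ) • x) (x : E) :
    (⟪M (M x), L (L x)⟫).im = -(2 * k * (⟪M x, L x⟫).re) := by
  rw [inner_sq_sq_of_commutator hL hM h]
  simp [-ofReal_pow]

/-- The Weyl quantization `a P² + b Q² + c (PQ + QP)` of a quadratic form. -/
def quadMap (P Q : E →ₗ[ℂ] E) (a b c : ℂ) : E →ₗ[ℂ] E :=
  a • (P ∘ₗ P) + b • (Q ∘ₗ Q) + c • (P ∘ₗ Q + Q ∘ₗ P)

theorem quadMap_apply (P Q : E →ₗ[ℂ] E) (a b c : ℂ) (x : E) :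
    quadMap P Q a b c x = a • P (P x) + b • Q (Q x) + c • (P (Q x) + Q (P x)) := rfl

variable {P Q : E →ₗ[ℂ] E} (hP : P.IsSymmetric) (hQ : Q.IsSymmetric)
  (hPQ : ∀ x, Q (P x) - P (Q x) = I • x)

include hP hQ

theorem inner_harmonic_self (x : E) :
    ⟪x, P (P x) + Q (Q x)⟫ = ((‖P x‖ ^ 2 + ‖Q x‖ ^ 2 : ℝ) : ℂ) := by
  rw [inner_add_right, ← hP, ← hQ, inner_self_eq_norm_sq_complex, inner_self_eq_norm_sq_complex]
  norm_cast

include hPQ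

/-- The cross term is a square minus a zero-order error, so `P²` and `Q²` cannot cancel each other.
-/
theorem norm_harmonic_sq (x : E) :
    ‖P (P x) + Q (Q x)‖ ^ 2
      = ‖P (P x)‖ ^ 2 + ‖Q (Q x)‖ ^ 2 + 2 * ‖Q (P x)‖ ^ 2 - 2 * ‖x‖ ^ 2 := by
  have h := re_inner_sq_sq_of_commutator hQ hP (k := 1) (by simpa using hPQ) x
  rw [norm_add_sq (𝕜 := ℂ)]
  simp only [RCLike.re_to_complex]
  rw [h]; ring

/-- The uncertainty principle. -/
theorem norm_sq_le_momentum_position (x : E) : ‖x‖ ^ 2 ≤ ‖P x‖ ^ 2 + ‖Q x‖ ^ 2 := by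
  have h := im_inner_of_commutator hQ hP (k := 1) (by simpa using hPQ) x
  have h1 := (abs_im_le_norm ⟪P x, Q x⟫).trans (norm_inner_le_norm _ _)
  have h2 := (abs_le.1 h1).1
  nlinarith [sq_nonneg (‖P x‖ - ‖Q x‖)]

/-- The shift by `1` adds `2(‖Px‖² + ‖Qx‖²) + ‖x‖²`, at least `3‖x‖²` by uncertainty, which
outweighs the commutator error `-2‖x‖²`. -/
theorem sq_add_le_norm_shifted_harmonic_sq (x : E) :
    ‖P (P x)‖ ^ 2 + ‖Q (Q x)‖ ^ 2 + 2 * ‖Q (P x)‖ ^ 2 + ‖x‖ ^ 2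
      ≤ ‖P (P x) + Q (Q x) + x‖ ^ 2 := by
  have h1 := norm_harmonic_sq hP hQ hPQ x
  have h2 := norm_sq_le_momentum_position hP hQ hPQ x
  have h3 := inner_harmonic_self hP hQ x
  rw [norm_add_sq (𝕜 := ℂ), h1, ← inner_conj_symm, h3]
  simp only [RCLike.re_to_complex, conj_re, ofReal_re]
  linarith

/-- A rank-one form quantizes to the square of `L = μP + νQ`, whose commutators with `P` and `Q` are
the scalars `νi` and `-μi`. -/
theorem neg_le_re_inner_harmonic_sq (μ ν : ℝ) (x : E) :
    -((μ ^ 2 + ν ^ 2) * ‖x‖ ^ 2) ≤ (⟪P (P x) + Q (Q x),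
      quadMap P Q ((μ ^ 2 : ℝ) : ℂ) ((ν ^ 2 : ℝ) : ℂ) ((μ * ν : ℝ) : ℂ) x⟫).re := by
  set L : E →ₗ[ℂ] E := (μ : ℂ) • P + (ν : ℂ) • Q with hLdef
  have hL : L.IsSymmetric := by
    intro y z
    simp only [hLdef, LinearMap.add_apply, LinearMap.smul_apply, inner_add_left, inner_add_right,
      inner_smul_left, inner_smul_right, conj_ofReal]
    rw [hP, hQ]
  have e : quadMap P Q ((μ ^ 2 : ℝ) : ℂ) ((ν ^ 2 : ℝ) : ℂ) ((μ * ν : ℝ) : ℂ) x = L (L x) := by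
    simp only [quadMap_apply, hLdef, LinearMap.add_apply, LinearMap.smul_apply, map_add, map_smul,
      ofReal_pow, ofReal_mul]
    module
  have hP' : ∀ y, L (P y) - P (L y) = (ν * I : ℂ) • y := by
    intro y
    rw [mul_smul, ← hPQ]
    simp only [hLdef, LinearMap.add_apply, LinearMap.smul_apply, map_add, map_smul]
    module
  have hQ' : ∀ y, L (Q y) - Q (L y) = ((-μ : ℝ) * I : ℂ) • y := by
    intro y
    rw [mul_smul, ← hPQ]
    simp only [hLdef, LinearMap.add_apply, LinearMap.smul_apply, map_add, map_smul, ofReal_neg]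
    module
  rw [e, inner_add_left, add_re, re_inner_sq_sq_of_commutator hL hP hP',
    re_inner_sq_sq_of_commutator hL hQ hQ']
  nlinarith [sq_nonneg ‖L (P x)‖, sq_nonneg ‖L (Q x)‖]

/-- For real coefficients the imaginary part sees only the commutator with `P² + Q²`, again
quadratic in `P, Q`. Writing `PQ + QP = (P + Q)² - P² - Q²` reduces it to pairings of squares. -/
theorem abs_im_inner_harmonic_le (a b c : ℝ) (x : E) :
    |(⟪P (P x) + Q (Q x), quadMap P Q (a : ℂ) (b : ℂ) (c : ℂ) x⟫).im|
      ≤ (|a - b| + 2 * |c|) * (‖P x‖ ^ 2 + ‖Q x‖ ^ 2) := by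
  have hL : (P + Q).IsSymmetric := hP.add hQ
  have hp : ∀ y, P (Q y) - Q (P y) = ((-1 : ℝ) * I : ℂ) • y := fun y => by
    rw [mul_smul, ← hPQ]; push_cast; module
  have hq : ∀ y, Q (P y) - P (Q y) = ((1 : ℝ) * I : ℂ) • y := fun y => by
    rw [hPQ]; push_cast; module
  have hLP : ∀ y, (P + Q) (P y) - P ((P + Q) y) = ((1 : ℝ) * I : ℂ) • y := fun y => by
    rw [← hq]; simp only [LinearMap.add_apply, map_add]; abel
  have hLQ : ∀ y, (P + Q) (Q y) - Q ((P + Q) y) = ((-1 : ℝ) * I : ℂ) • y := fun y => by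
    rw [← hp]; simp only [LinearMap.add_apply, map_add]; abel
  have e : quadMap P Q (a : ℂ) (b : ℂ) (c : ℂ) x = ((a - c : ℝ) : ℂ) • P (P x)
      + ((b - c : ℝ) : ℂ) • Q (Q x) + (c : ℂ) • (P + Q) ((P + Q) x) := by
    simp only [quadMap_apply, LinearMap.add_apply, map_add, ofReal_sub]
    module
  have hρ : (⟪Q x, P x⟫).re = (⟪P x, Q x⟫).re := by
    exact inner_re_symm (𝕜 := ℂ) (Q x) (P x)
  have key : (⟪P (P x) + Q (Q x), quadMap P Q (a : ℂ) (b : ℂ) (c : ℂ) x⟫).im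
      = 2 * (a - b) * (⟪P x, Q x⟫).re + 2 * c * (‖Q x‖ ^ 2 - ‖P x‖ ^ 2) := by
    have h1 := im_inner_sq_sq_of_commutator hP hQ hp x
    have h2 := im_inner_sq_sq_of_commutator hQ hP hq x
    have h3 := im_inner_sq_sq_of_commutator hL hP hLP x
    have h4 := im_inner_sq_sq_of_commutator hL hQ hLQ x
    rw [LinearMap.add_apply P Q x, inner_add_right, inner_self_eq_norm_sq_complex, add_re,
      ← LinearMap.add_apply P Q x] at h3 h4
    rw [ofReal_re] at h3 h4
    rw [hρ] at h1 h4
    simp only [e, inner_add_left, inner_add_right, inner_smul_right, add_im, mul_im, ofReal_re,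
      ofReal_im, zero_mul, add_zero, inner_self_eq_norm_sq_complex] at h1 h2 h3 h4 ⊢
    rw [h1, h2, h3, h4]
    ring
  have hb : |(⟪P x, Q x⟫).re| ≤ (‖P x‖ ^ 2 + ‖Q x‖ ^ 2) / 2 := by
    have h1 := (abs_re_le_norm ⟪P x, Q x⟫).trans (norm_inner_le_norm _ _)
    nlinarith [sq_nonneg (‖P x‖ - ‖Q x‖)]
  have hd : |‖Q x‖ ^ 2 - ‖P x‖ ^ 2| ≤ ‖P x‖ ^ 2 + ‖Q x‖ ^ 2 := by
    rw [abs_le]; constructor <;> nlinarith [sq_nonneg ‖P x‖, sq_nonneg ‖Q x‖]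
  rw [key]
  refine (abs_add_le _ _).trans ?_
  simp only [abs_mul, abs_two]
  nlinarith [mul_le_mul_of_nonneg_left hb (abs_nonneg (a - b)),
    mul_le_mul_of_nonneg_left hd (abs_nonneg c)]

/-- A Gårding inequality for Weyl quantizations of quadratic forms with positive real part. -/
theorem exists_re_inner_harmonic_quadMap_ge {a b c : ℂ} (ha : 0 < a.re)
    (hc : c.re ^ 2 < a.re * b.re) :
    ∃ ε : ℝ, 0 < ε ∧ ∃ C : ℝ, 0 ≤ C ∧ ∀ x : E,
      ε * ‖P (P x) + Q (Q x)‖ ^ 2 - C * (‖x‖ ^ 2 + ‖x‖ * ‖P (P x) + Q (Q x)‖)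
        ≤ (⟪P (P x) + Q (Q x), quadMap P Q a b c x⟫).re := by
  have hab : 0 < a.re * b.re := lt_of_le_of_lt (sq_nonneg _) hc
  have hb : 0 < b.re := (mul_pos_iff_of_pos_left ha).1 hab
  -- Determinant over trace of the real part. Subtracting `ε` from both diagonal entries leaves
  -- determinant `ε²`, so completing the square gives `r(ξ + κη)² + sη²` with `r > 0` and `s ≥ 0`.
  set ε := (a.re * b.re - c.re ^ 2) / (a.re + b.re) with hε
  have hsum : 0 < a.re + b.re := by linarith
  have hε0 : 0 < ε := div_pos (by linarith) hsum
  have hεm : ε * (a.re + b.re) = a.re * b.re - c.re ^ 2 := div_mul_cancel₀ _ hsum.ne'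
  set r := a.re - ε with hr
  have hr0 : 0 < r := by
    have h1 : 0 < r * (a.re + b.re) := by
      have : r * (a.re + b.re) = a.re ^ 2 + c.re ^ 2 := by rw [hr, sub_mul, hεm]; ring
      rw [this]; positivity
    exact (mul_pos_iff_of_pos_right hsum).1 h1
  set κ := c.re / r with hκ
  have hκr : r * κ = c.re := mul_div_cancel₀ _ hr0.ne'
  set s := b.re - ε - r * κ ^ 2 with hs
  have hs0 : 0 ≤ s := by
    have h1 : 0 ≤ r * s := by
      have : r * s = ε ^ 2 := by
        rw [hs, mul_sub, show r * (r * κ ^ 2) = (r * κ) ^ 2 by ring, hκr, hr]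
        linear_combination -hεm
      rw [this]; positivity
    exact nonneg_of_mul_nonneg_right h1 hr0
  refine ⟨ε, hε0, r * (1 + κ ^ 2) + s + (|a.im - b.im| + 2 * |c.im|), by positivity,
    fun x => ?_⟩
  have e : quadMap P Q a b c x = (ε : ℂ) • (P (P x) + Q (Q x))
      + (r : ℂ) • quadMap P Q ((1 ^ 2 : ℝ) : ℂ) ((κ ^ 2 : ℝ) : ℂ) ((1 * κ : ℝ) : ℂ) x
      + (s : ℂ) • quadMap P Q ((0 ^ 2 : ℝ) : ℂ) ((1 ^ 2 : ℝ) : ℂ) ((0 * 1 : ℝ) : ℂ) x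
      + I • quadMap P Q (a.im : ℂ) (b.im : ℂ) (c.im : ℂ) x := by
    have ha' : a = ((ε + r : ℝ) : ℂ) + I * a.im := by
      rw [hr, add_sub_cancel, mul_comm, re_add_im]
    have hb' : b = ((ε + r * κ ^ 2 + s : ℝ) : ℂ) + I * b.im := by
      rw [hs, show ε + r * κ ^ 2 + (b.re - ε - r * κ ^ 2) = b.re by ring, mul_comm, re_add_im]
    have hc' : c = ((r * κ : ℝ) : ℂ) + I * c.im := by
      rw [hκr, mul_comm, re_add_im]
    simp only [quadMap_apply]
    nth_rewrite 1 [ha', hb', hc']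
    push_cast
    module
  have h1 := neg_le_re_inner_harmonic_sq hP hQ hPQ 1 κ x
  have h2 := neg_le_re_inner_harmonic_sq hP hQ hPQ 0 1 x
  have h3 := abs_im_inner_harmonic_le hP hQ hPQ a.im b.im c.im x
  have h4 : ‖P x‖ ^ 2 + ‖Q x‖ ^ 2 ≤ ‖x‖ * ‖P (P x) + Q (Q x)‖ := by
    have := norm_inner_le_norm (𝕜 := ℂ) x (P (P x) + Q (Q x))
    rw [inner_harmonic_self hP hQ, norm_real, Real.norm_of_nonneg (by positivity)] at this
    exact this
  rw [e, inner_add_right, inner_add_right, inner_add_right]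
  simp only [inner_smul_right, add_re, re_ofReal_mul,
    I_mul_re, inner_self_eq_norm_sq_complex, ofReal_re]
  have h5 := (abs_le.1 h3).2
  set K := |a.im - b.im| + 2 * |c.im| with hK
  have hK0 : 0 ≤ K := by positivity
  have h6 : 0 ≤ ‖x‖ * ‖P (P x) + Q (Q x)‖ := by positivity
  have h7 := mul_le_mul_of_nonneg_left h4 hK0
  have h8 := mul_le_mul_of_nonneg_left h1 hr0.le
  have h9 := mul_le_mul_of_nonneg_left h2 hs0
  have h10 : 0 ≤ (r * (1 + κ ^ 2) + s) * (‖x‖ * ‖P (P x) + Q (Q x)‖) := by positivity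
  have h11 : 0 ≤ K * ‖x‖ ^ 2 := by positivity
  nlinarith

end CanonicalPair

/-! ### Abstract Hilbert space tools: coercivity, adjoints, convergence -/

section Coercive

variable {F : Type*} [NormedAddCommGroup F] [InnerProductSpace ℂ F] [CompleteSpace F]
  {D : Type*} [AddCommGroup D] [Module ℂ D]

/-- If `N` maps onto a Hilbert space, `A` is `N`-bounded and `⟪N u, A u⟫` is coercive with respect
to `N`, then `A` is onto. -/
theorem surjective_of_coercive {N A : D →ₗ[ℂ] F} (hN : Function.Surjective N)
    {C c : ℝ} (hc : 0 < c) (hA : ∀ u, ‖A u‖ ≤ C * ‖N u‖)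
    (hco : ∀ u, c * ‖N u‖ ^ 2 ≤ (⟪N u, A u⟫).re) : Function.Surjective A := by
  -- Any linear right inverse will do: `A ∘ R` is bounded because `A` is `N`-bounded, and coercive,
  -- so Lax-Milgram inverts it.
  obtain ⟨R, hR⟩ := N.exists_rightInverse_of_surjective (LinearMap.range_eq_top.2 hN)
  have hR' : ∀ x, N (R x) = x := fun x => LinearMap.congr_fun hR x
  let S : F →L[ℂ] F := (A ∘ₗ R).mkContinuous C fun x => by
    simpa [hR'] using hA (R x)
  have hS : IsUnit S := by
    refine ContinuousLinearMap.isUnit_of_forall_le_norm_inner_map S (c := ⟨c, hc.le⟩) hc fun x => ?_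
    have h1 := hco (R x)
    rw [hR'] at h1
    have h2 : (⟪x, A (R x)⟫).re ≤ ‖⟪S x, x⟫‖ := by
      rw [norm_inner_symm]
      exact re_le_norm _
    calc ‖x‖ ^ 2 * c = c * ‖x‖ ^ 2 := mul_comm _ _
      _ ≤ _ := h1.trans h2
  intro y
  obtain ⟨T, hT⟩ := hS.exists_right_inv
  exact ⟨R (T y), congrArg (fun Z : F →L[ℂ] F => Z y) hT⟩

/-- Formally adjoint operators on a common domain are adjoint to each other if suitable shifts of
both of them are onto. -/
theorem adjoint_eq_of_surjective {A B : F →ₗ.[ℂ] F} (hD : Dense (A.domain : Set F))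
    (hAB : A.IsFormalAdjoint B) (κ μ : ℂ)
    (hA : ∀ f : F, ∃ u : A.domain, κ • A u + μ • (u : F) = f)
    (hB : ∀ f : F, ∃ u : B.domain, star κ • B u + star μ • (u : F) = f) : A† = B := by
  have hle : B ≤ A† := hAB.le_adjoint hD
  refine (LinearPMap.eq_of_le_of_domain_eq hle (le_antisymm hle.1 fun w hw => ?_)).symm
  -- With this `u`, the difference `w - u` is orthogonal to the range of `κA + μ`. That range
  -- contains `w - u` itself, as the image of `v`.
  obtain ⟨u, hu⟩ := hB (star κ • A† ⟨w, hw⟩ + star μ • w)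
  obtain ⟨v, hv⟩ := hA (w - u)
  have h1 : ⟪A† ⟨w, hw⟩, (v : F)⟫ = ⟪w, A v⟫ :=
    LinearPMap.adjoint_isFormalAdjoint hD ⟨w, hw⟩ v
  have h2 : ⟪B u, (v : F)⟫ = ⟪(u : F), A v⟫ := by
    have := hAB.symm u v
    exact this
  have h3 : ⟪star κ • B u + star μ • (u : F), (v : F)⟫ = ⟪(u : F), κ • A v + μ • (v : F)⟫ := by
    simp only [inner_add_left, inner_add_right, inner_smul_left, inner_smul_right, h2]
    simp
  have h4 : ⟪star κ • A† ⟨w, hw⟩ + star μ • w, (v : F)⟫ = ⟪w, κ • A v + μ • (v : F)⟫ := by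
    simp only [inner_add_left, inner_add_right, inner_smul_left, inner_smul_right, h1]
    simp
  have h5 : ⟪w - u, w - u⟫ = 0 := by
    nth_rewrite 2 [← hv]
    rw [inner_sub_left, ← h3, ← h4, hu, sub_self]
  rw [inner_self_eq_zero, sub_eq_zero] at h5
  rw [h5]; exact u.2

/-- Convergence in `F` of `B φₙ` forces that of `K φₙ` if `K` is `B`-bounded. -/
theorem exists_tendsto_of_norm_le {K B : D →ₗ[ℂ] F} {C : ℝ}
    (h : ∀ φ, ‖K φ‖ ≤ C * ‖B φ‖) {φ : ℕ → D} {f : F}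
    (hf : Filter.Tendsto (fun n => B (φ n)) Filter.atTop (nhds f)) :
    ∃ g, Filter.Tendsto (fun n => K (φ n)) Filter.atTop (nhds g) := by
  refine cauchySeq_tendsto_of_complete ?_
  have hc := hf.cauchySeq
  rw [Metric.cauchySeq_iff] at hc ⊢
  intro ε hε
  have hC : 0 < |C| + 1 := by positivity
  obtain ⟨N, hN⟩ := hc (ε / (|C| + 1)) (div_pos hε hC)
  refine ⟨N, fun m hm n hn => ?_⟩
  have h1 := hN m hm n hn
  rw [dist_eq_norm, ← map_sub] at h1 ⊢
  rw [lt_div_iff₀ hC] at h1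
  have h2 := h (φ m - φ n)
  nlinarith [norm_nonneg (B (φ m - φ n)),
    mul_le_mul_of_nonneg_right (le_abs_self C) (norm_nonneg (B (φ m - φ n)))]

end Coercive

/-! ### Test functions -/

theorem IsTest.mul {f φ : ℝ → ℂ} (h : IsTest φ) (hf : ContDiff ℝ (⊤ : ℕ∞) f) :
    IsTest (fun x => f x * φ x) :=
  ⟨hf.mul h.1, h.2.mul_left (f := f)⟩

theorem IsTest.mul_right {f φ : ℝ → ℂ} (h : IsTest φ) (hf : ContDiff ℝ (⊤ : ℕ∞) f) :
    IsTest (fun x => φ x * f x) :=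
  ⟨h.1.mul hf, h.2.mul_right⟩

theorem IsTest.conj {φ : ℝ → ℂ} (h : IsTest φ) : IsTest (fun x => conj (φ x)) :=
  ⟨conjCLE.contDiff.comp h.1, h.2.comp_left (g := conj) (map_zero _)⟩

theorem IsTest.memLp {φ : ℝ → ℂ} (h : IsTest φ) : MemLp φ 2 (volume : Measure ℝ) :=
  h.1.continuous.memLp_of_hasCompactSupport h.2

theorem IsTest.differentiable {φ : ℝ → ℂ} (h : IsTest φ) : Differentiable ℝ φ :=
  h.1.differentiable (by simp)

theorem IsTest.hasDerivAt {φ : ℝ → ℂ} (h : IsTest φ) (x : ℝ) :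
    HasDerivAt φ (_root_.deriv φ x) x :=
  (h.differentiable x).hasDerivAt

theorem IsTest.integrable {φ : ℝ → ℂ} (h : IsTest φ) : Integrable φ :=
  h.1.continuous.integrable_of_hasCompactSupport h.2

theorem IsTest.integral_deriv_mul {φ ψ : ℝ → ℂ} (h : IsTest φ) (hψ : ContDiff ℝ (⊤ : ℕ∞) ψ) :
    ∫ x, _root_.deriv φ x * ψ x = -∫ x, φ x * _root_.deriv ψ x := by
  have h1 := integral_mul_deriv_eq_deriv_mul_of_integrable (u := φ) (v := ψ)
    (fun x _ => h.hasDerivAt x) (fun x _ => (hψ.differentiable (by simp) x).hasDerivAt)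
    (h.mul_right (contDiff_infty_iff_deriv.1 hψ).2).integrable
    (h.deriv.mul_right hψ).integrable (h.mul_right hψ).integrable
  rw [h1, neg_neg]

theorem deriv_conj_comp {φ : ℝ → ℂ} (h : IsTest φ) (x : ℝ) :
    deriv (fun y => conj (φ y)) x = conj (deriv φ x) := by
  exact (conjCLE.hasFDerivAt.comp_hasDerivAt x (h.hasDerivAt x)).deriv

theorem ae_eq_zero_of_integral_mul_test {f : ℝ → ℂ} (hf : LocallyIntegrable f volume)
    (h : ∀ φ, IsTest φ → ∫ x, f x * φ x = 0) : f =ᵐ[volume] 0 := by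
  refine ae_eq_zero_of_integral_contDiff_smul_eq_zero hf fun g hg hgc => ?_
  rw [← h (fun x => (g x : ℂ))
    ⟨Complex.ofRealCLM.contDiff.comp hg, hgc.comp_left (g := Complex.ofReal) (by simp)⟩]
  refine integral_congr_ae (Filter.Eventually.of_forall fun x => ?_)
  simp [mul_comm]

theorem locallyIntegrable_continuous_mul {f : ℝ → ℂ} (hf : Continuous f) (u : H) :
    LocallyIntegrable (fun x => f x * u x) volume := by
  have h := (Lp.memLp u).locallyIntegrable (μ := (volume : Measure ℝ)) (by norm_num)
  rw [← locallyIntegrableOn_univ] at h ⊢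
  exact h.continuousOn_mul hf.continuousOn isOpen_univ.isLocallyClosed

theorem inner_eq_integral {u v : H} {f : ℝ → ℂ} (hu : u =ᵐ[volume] f) :
    ⟪u, v⟫ = ∫ x, v x * conj (f x) := by
  rw [L2.inner_def]
  refine integral_congr_ae ?_
  filter_upwards [hu] with x hx
  rw [hx]; rfl

/-! ### The canonical pair on test functions -/

theorem mem_graph_p_of_test {u w : H} {φ : ℝ → ℂ} (hφ : IsTest φ) (hu : u =ᵐ[volume] φ)
    (hw : w =ᵐ[volume] fun x => -I * deriv φ x) : (u, w) ∈ p.graph := by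
  rw [graph_p]
  intro ψ hψ
  have h1 : ∫ x, w x * ψ x = -I * ∫ x, deriv φ x * ψ x := by
    rw [← integral_const_mul]
    refine integral_congr_ae ?_
    filter_upwards [hw] with x hx
    rw [hx, mul_assoc]
  have h2 : ∫ x, u x * deriv ψ x = ∫ x, φ x * deriv ψ x := by
    refine integral_congr_ae ?_
    filter_upwards [hu] with x hx
    rw [hx]
  change ∫ x, w x * ψ x = I * ∫ x, u x * deriv ψ x
  rw [h1, h2, hφ.integral_deriv_mul hψ.1]
  ring

theorem exists_p_of_test {u : H} {φ : ℝ → ℂ} (hφ : IsTest φ) (hu : u =ᵐ[volume] φ) :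
    ∃ h : u ∈ p.domain, p ⟨u, h⟩ =ᵐ[volume] fun x => -I * deriv φ x := by
  have hw := (hφ.deriv.mul (f := fun _ => -I) contDiff_const).memLp
  have h := mem_graph_p_of_test hφ hu hw.coeFn_toLp
  rw [LinearPMap.mem_graph_iff] at h
  obtain ⟨y, hy, hy'⟩ := h
  subst hy
  refine ⟨y.2, ?_⟩
  change p y =ᵐ[volume] _
  rw [hy']
  exact hw.coeFn_toLp

theorem mulOp_apply_ae (f : ℝ → ℝ) (u : (mulOp f).domain) :
    mulOp f u =ᵐ[volume] fun x => (f x : ℂ) * (u : H) x :=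
  MemLp.coeFn_toLp (f := fun x => (f x : ℂ) * (u : H) x) u.2

theorem exists_q_of_test {u : H} {φ : ℝ → ℂ} (hφ : IsTest φ) (hu : u =ᵐ[volume] φ) :
    ∃ h : u ∈ q.domain, q ⟨u, h⟩ =ᵐ[volume] fun x => (x : ℂ) * φ x := by
  have hae : (fun x : ℝ => (x : ℂ) * φ x) =ᵐ[volume] fun x => (x : ℂ) * u x := by
    filter_upwards [hu] with x hx
    rw [hx]
  have h : u ∈ q.domain :=
    (hφ.mul (f := fun x => (x : ℂ)) ofRealCLM.contDiff).memLp.ae_eq hae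
  exact ⟨h, (mulOp_apply_ae _ ⟨u, h⟩).trans hae.symm⟩

theorem testSubmodule_le_domain_p : testSubmodule ≤ p.domain := fun _ ⟨_, hφ, hu⟩ =>
  (exists_p_of_test hφ hu).1

theorem testSubmodule_le_domain_q : testSubmodule ≤ q.domain := fun _ ⟨_, hφ, hu⟩ =>
  (exists_q_of_test hφ hu).1

/-- The momentum operator on test functions. -/
def testP : testSubmodule →ₗ[ℂ] testSubmodule where
  toFun u := ⟨p ⟨u, testSubmodule_le_domain_p u.2⟩, by
    obtain ⟨φ, hφ, hu⟩ := u.2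
    exact ⟨_, hφ.deriv.mul (f := fun _ => -I) contDiff_const, (exists_p_of_test hφ hu).2⟩⟩
  map_add' u v := Subtype.ext (p.map_add ⟨u, _⟩ ⟨v, _⟩)
  map_smul' c u := Subtype.ext (p.map_smul c ⟨u, _⟩)

/-- The position operator on test functions. -/
def testQ : testSubmodule →ₗ[ℂ] testSubmodule where
  toFun u := ⟨q ⟨u, testSubmodule_le_domain_q u.2⟩, by
    obtain ⟨φ, hφ, hu⟩ := u.2
    exact ⟨_, hφ.mul (f := fun x => (x : ℂ)) ofRealCLM.contDiff, (exists_q_of_test hφ hu).2⟩⟩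
  map_add' u v := Subtype.ext (q.map_add ⟨u, _⟩ ⟨v, _⟩)
  map_smul' c u := Subtype.ext (q.map_smul c ⟨u, _⟩)

theorem testP_ae {u : testSubmodule} {φ : ℝ → ℂ} (hφ : IsTest φ) (hu : (u : H) =ᵐ[volume] φ) :
    (testP u : H) =ᵐ[volume] fun x => -I * deriv φ x :=
  (exists_p_of_test hφ hu).2

theorem testQ_ae {u : testSubmodule} {φ : ℝ → ℂ} (hφ : IsTest φ) (hu : (u : H) =ᵐ[volume] φ) :
    (testQ u : H) =ᵐ[volume] fun x => (x : ℂ) * φ x :=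
  (exists_q_of_test hφ hu).2

theorem IsTest.exists_testSubmodule {φ : ℝ → ℂ} (hφ : IsTest φ) :
    ∃ u : testSubmodule, (u : H) =ᵐ[volume] φ :=
  ⟨⟨hφ.memLp.toLp φ, φ, hφ, hφ.memLp.coeFn_toLp⟩, hφ.memLp.coeFn_toLp⟩

/-- `p` is the adjoint of its restriction to test functions. -/
theorem mem_graph_p_iff (u w : H) :
    (u, w) ∈ p.graph ↔ ∀ φ : testSubmodule, ⟪(φ : H), w⟫ = ⟪(testP φ : H), u⟫ := by
  have key : ∀ (φ : testSubmodule) (f : ℝ → ℂ), IsTest f → (φ : H) =ᵐ[volume] f →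
      (⟪(φ : H), w⟫ = ⟪(testP φ : H), u⟫ ↔
        ∫ x, w x * conj (f x) = I * ∫ x, u x * deriv (fun y => conj (f y)) x) := by
    intro φ f hf hφ
    rw [inner_eq_integral hφ, inner_eq_integral (testP_ae hf hφ), ← integral_const_mul]
    have e : (fun x => u x * conj (-I * deriv f x))
        = fun x => I * (u x * deriv (fun y => conj (f y)) x) := by
      funext x
      rw [deriv_conj_comp hf, map_mul, map_neg, conj_I]
      ring
    rw [e]
  rw [graph_p]
  constructor
  · intro h φ
    obtain ⟨f, hf, hφ⟩ := φ.2
    exact (key φ f hf hφ).2 (h _ hf.conj)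
  · intro h f hf
    obtain ⟨φ, hφ⟩ := hf.conj.exists_testSubmodule
    simpa using (key φ _ hf.conj hφ).1 (h φ)

/-- `q` is the adjoint of its restriction to test functions. -/
theorem mem_graph_q_iff (u w : H) :
    (u, w) ∈ q.graph ↔ ∀ φ : testSubmodule, ⟪(φ : H), w⟫ = ⟪(testQ φ : H), u⟫ := by
  have hint : ∀ f, IsTest f → Integrable (fun x : ℝ => (x : ℂ) * u x * f x) := fun f hf =>
    (integrable_mul_test u (hf.mul (f := fun x => (x : ℂ)) ofRealCLM.contDiff)).congr
      (Filter.Eventually.of_forall fun x => by ring_nf)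
  have key : ∀ (φ : testSubmodule) (f : ℝ → ℂ), IsTest f → (φ : H) =ᵐ[volume] f →
      (⟪(φ : H), w⟫ = ⟪(testQ φ : H), u⟫ ↔ ∫ x, (w x - (x : ℂ) * u x) * conj (f x) = 0) := by
    intro φ f hf hφ
    rw [inner_eq_integral hφ, inner_eq_integral (testQ_ae hf hφ)]
    simp only [sub_mul]
    rw [integral_sub (integrable_mul_test w hf.conj) (hint _ hf.conj), sub_eq_zero]
    have e : (fun x : ℝ => u x * conj ((x : ℂ) * f x)) = fun x : ℝ => (x : ℂ) * u x * conj (f x) := by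
      funext x
      rw [map_mul, conj_ofReal]
      ring
    rw [e]
  constructor
  · intro h φ
    rw [LinearPMap.mem_graph_iff] at h
    obtain ⟨y, hy, hw⟩ := h
    change (y : H) = u at hy
    change q y = w at hw
    subst hy hw
    obtain ⟨f, hf, hφ⟩ := φ.2
    refine (key φ f hf hφ).2 ?_
    rw [← integral_zero ℝ ℂ]
    refine integral_congr_ae ?_
    filter_upwards [mulOp_apply_ae _ y] with x hx
    rw [show q y x = (x : ℂ) * (y : H) x from hx, sub_self, zero_mul]
  · intro h
    have h0 : (fun x => w x - (x : ℂ) * u x) =ᵐ[volume] 0 := by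
      refine ae_eq_zero_of_integral_mul_test ?_ fun f hf => ?_
      · exact ((Lp.memLp w).locallyIntegrable (by norm_num)).sub
          (locallyIntegrable_continuous_mul (f := fun x => (x : ℂ)) continuous_ofReal u)
      · obtain ⟨φ, hφ⟩ := hf.conj.exists_testSubmodule
        simpa using (key φ _ hf.conj hφ).1 (h φ)
    have h1 : (w : ℝ → ℂ) =ᵐ[volume] fun x => (x : ℂ) * u x := by
      filter_upwards [h0] with x hx
      exact sub_eq_zero.1 hx
    have hu : u ∈ q.domain := (Lp.memLp w).ae_eq h1
    rw [LinearPMap.mem_graph_iff]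
    refine ⟨⟨u, hu⟩, rfl, ?_⟩
    exact Lp.ext ((mulOp_apply_ae _ ⟨u, hu⟩).trans h1.symm)

theorem testP_isSymmetric : testP.IsSymmetric := fun φ ψ =>
  ((mem_graph_p_iff ψ (testP ψ)).1 (p.mem_graph ⟨ψ, testSubmodule_le_domain_p ψ.2⟩) φ).symm

theorem testQ_isSymmetric : testQ.IsSymmetric := fun φ ψ =>
  ((mem_graph_q_iff ψ (testQ ψ)).1 (q.mem_graph ⟨ψ, testSubmodule_le_domain_q ψ.2⟩) φ).symm

theorem deriv_ofReal_mul {φ : ℝ → ℂ} (h : IsTest φ) (x : ℝ) :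
    deriv (fun y : ℝ => (y : ℂ) * φ y) x = φ x + x * deriv φ x := by
  have := ((hasDerivAt_id x).ofReal_comp.mul (h.hasDerivAt x)).deriv
  simp only [ofReal_one, one_mul, id] at this
  exact this

theorem testQ_testP_sub (u : testSubmodule) :
    testQ (testP u) - testP (testQ u) = I • u := by
  obtain ⟨φ, hφ, hu⟩ := u.2
  have h1 := testQ_ae (hφ.deriv.mul (f := fun _ => -I) contDiff_const) (testP_ae hφ hu)
  have h2 := testP_ae (hφ.mul (f := fun x => (x : ℂ)) ofRealCLM.contDiff) (testQ_ae hφ hu)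
  refine Subtype.ext (Lp.ext ?_)
  filter_upwards [h1, h2, hu, Lp.coeFn_sub (testQ (testP u) : H) (testP (testQ u) : H),
    Lp.coeFn_smul I (u : H)] with x h1 h2 h3 h4 h5
  refine h4.trans (Eq.trans ?_ h5.symm)
  rw [Pi.sub_apply, Pi.smul_apply, h1, h2, h3, deriv_ofReal_mul hφ, smul_eq_mul]
  ring

/-! ### The harmonic oscillator has no null vectors -/

/-- A test function with vanishing integral is the derivative of a test function. -/
theorem IsTest.exists_antideriv {χ : ℝ → ℂ} (h : IsTest χ) (h0 : ∫ x, χ x = 0) :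
    ∃ θ, IsTest θ ∧ ∀ x, HasDerivAt θ (χ x) x := by
  obtain ⟨R, hR⟩ := h.2.isCompact.isBounded.subset_closedBall (0 : ℝ)
  have hzero : ∀ x, R < |x| → χ x = 0 := fun x hx => by
    by_contra hne
    have := hR (subset_tsupport χ hne)
    rw [mem_closedBall_zero_iff, Real.norm_eq_abs] at this
    linarith
  -- The base point lies to the left of the support, so the primitive vanishes far to the left; far
  -- to the right it is the total integral, zero by `h0`.
  have hd : ∀ x, HasDerivAt (fun y => ∫ t in (-R - 1)..y, χ t) (χ x) x := fun x =>
    (h.1.continuous.integral_hasStrictDerivAt (-R - 1) x).hasDerivAt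
  refine ⟨_, ⟨?_, ?_⟩, hd⟩
  · rw [contDiff_infty_iff_deriv]
    refine ⟨fun x => (hd x).differentiableAt, ?_⟩
    rw [show _root_.deriv (fun y => ∫ t in (-R - 1)..y, χ t) = χ from funext fun x => (hd x).deriv]
    exact h.1
  · refine HasCompactSupport.intro (isCompact_closedBall (0 : ℝ) |R|) fun x hx => ?_
    rw [mem_closedBall_zero_iff, Real.norm_eq_abs, not_le] at hx
    have hR' := le_abs_self R
    rcases lt_abs.1 hx with hx | hx
    · rw [intervalIntegral.integral_eq_integral_of_support_subset, h0]
      intro t ht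
      by_contra hne
      refine ht (hzero t ?_)
      rw [Set.mem_Ioc, not_and_or, not_lt, not_le] at hne
      rw [lt_abs]
      rcases hne with hne | hne
      · right; linarith
      · left; linarith
    · rw [← intervalIntegral.integral_zero (a := -R - 1) (b := x)]
      refine intervalIntegral.integral_congr fun t ht => hzero t ?_
      have := ht.2
      rw [lt_abs]
      right
      rcases le_max_iff.1 this with h1 | h1 <;> linarith

/-- The Gaussian error integral `∫₀ˣ exp (-t²) dt`. -/
def erfInt (x : ℝ) : ℝ := ∫ t in (0 : ℝ)..x, Real.exp (-t ^ 2)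

theorem hasDerivAt_erfInt (x : ℝ) : HasDerivAt erfInt (Real.exp (-x ^ 2)) x :=
  (Continuous.integral_hasStrictDerivAt (by fun_prop) 0 x).hasDerivAt

theorem contDiff_erfInt : ContDiff ℝ (⊤ : ℕ∞) erfInt := by
  rw [contDiff_infty_iff_deriv]
  refine ⟨fun x => (hasDerivAt_erfInt x).differentiableAt, ?_⟩
  rw [show deriv erfInt = fun x => Real.exp (-x ^ 2) from
    funext fun x => (hasDerivAt_erfInt x).deriv]
  fun_prop

theorem erfInt_neg (x : ℝ) : erfInt (-x) = -erfInt x := by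
  have h := intervalIntegral.integral_comp_neg (a := 0) (b := x) (fun t => Real.exp (-t ^ 2))
  simp only [neg_sq, neg_zero] at h
  rw [erfInt, intervalIntegral.integral_symm, ← h, erfInt]

theorem strictMono_erfInt : StrictMono erfInt :=
  strictMono_of_deriv_pos fun x => by rw [(hasDerivAt_erfInt x).deriv]; exact Real.exp_pos _

theorem erfInt_one_pos : 0 < erfInt 1 := by
  have h : erfInt 0 = 0 := intervalIntegral.integral_same
  rw [← h]
  exact strictMono_erfInt one_pos

/-- The shifted harmonic oscillator `P² + Q² + 1` on test functions. -/
def testN : testSubmodule →ₗ[ℂ] testSubmodule :=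
  testP ∘ₗ testP + testQ ∘ₗ testQ + LinearMap.id

theorem testN_apply (u : testSubmodule) :
    testN u = testP (testP u) + testQ (testQ u) + u := rfl

theorem testN_ae {u : testSubmodule} {φ : ℝ → ℂ} (hφ : IsTest φ) (hu : (u : H) =ᵐ[volume] φ) :
    (testN u : H) =ᵐ[volume] fun x => -deriv (deriv φ) x + (x : ℂ) ^ 2 * φ x + φ x := by
  have h1 := testP_ae (hφ.deriv.mul (f := fun _ => -I) contDiff_const) (testP_ae hφ hu)
  have h2 := testQ_ae (hφ.mul (f := fun x => (x : ℂ)) ofRealCLM.contDiff) (testQ_ae hφ hu)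
  filter_upwards [h1, h2, hu, Lp.coeFn_add (testP (testP u) : H) (testQ (testQ u) : H),
    Lp.coeFn_add ((testP (testP u) : H) + (testQ (testQ u) : H)) (u : H)] with x h1 h2 h3 h4 h5
  refine h5.trans ?_
  rw [Pi.add_apply, h4, Pi.add_apply, h1, h2, h3, deriv_const_mul _ (hφ.deriv.differentiable x)]
  linear_combination (deriv (deriv φ) x) * I_mul_I

theorem hasDerivAt_gaussian (c x : ℝ) :
    HasDerivAt (fun y : ℝ => ((Real.exp (c * y ^ 2) : ℝ) : ℂ))
      (2 * c * x * (Real.exp (c * x ^ 2) : ℝ)) x := by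
  have h := (((hasDerivAt_pow 2 x).const_mul c).exp).ofReal_comp
  convert! h using 1
  push_cast
  ring

theorem contDiff_gaussian (c : ℝ) :
    ContDiff ℝ (⊤ : ℕ∞) (fun y : ℝ => ((Real.exp (c * y ^ 2) : ℝ) : ℂ)) :=
  ofRealCLM.contDiff.comp (f := fun y : ℝ => Real.exp (c * y ^ 2)) (by fun_prop)

/-- The equation `-φ'' + x² φ + φ = -exp (-x² / 2) χ` is solvable in test functions if `χ` is
orthogonal to `1` and to the error integral. -/
theorem IsTest.exists_harmonic_solution {χ : ℝ → ℂ} (h : IsTest χ) (h0 : ∫ x, χ x = 0)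
    (h1 : ∫ x, χ x * (erfInt x : ℂ) = 0) :
    ∃ φ, IsTest φ ∧ ∀ x, -_root_.deriv (_root_.deriv φ) x + (x : ℂ) ^ 2 * φ x + φ x
      = -((Real.exp (-1 / 2 * x ^ 2) : ℝ) * χ x) := by
  obtain ⟨θ, hθ, hθ'⟩ := h.exists_antideriv h0
  have hθd : _root_.deriv θ = χ := funext fun x => (hθ' x).deriv
  have hE : ContDiff ℝ (⊤ : ℕ∞) (fun x => (erfInt x : ℂ)) := ofRealCLM.contDiff.comp contDiff_erfInt
  have hE' : ∀ x, _root_.deriv (fun x => (erfInt x : ℂ)) x = (Real.exp (-1 * x ^ 2) : ℝ) :=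
    fun x => by rw [(hasDerivAt_erfInt x).ofReal_comp.deriv, neg_one_mul]
  -- Integration by parts turns orthogonality of `χ` to the error integral into `∫ θ exp(-x²) = 0`,
  -- which permits a second antiderivative.
  have h2 := hθ.integral_deriv_mul hE
  rw [hθd, h1] at h2
  simp only [hE'] at h2
  obtain ⟨ζ, hζ, hζ'⟩ := (hθ.mul_right (contDiff_gaussian (-1))).exists_antideriv
    (neg_eq_zero.1 h2.symm)
  -- The operator factors as `-(d/dx + x)(d/dx - x)`, and Gaussian factors turn each bracket into a
  -- plain derivative: `ζ' = exp(-x²) θ` and `θ' = χ`.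
  refine ⟨fun x => (Real.exp (1 / 2 * x ^ 2) : ℝ) * ζ x, hζ.mul (contDiff_gaussian _), ?_⟩
  have hexp : ∀ x : ℝ, ((Real.exp (1 / 2 * x ^ 2) : ℝ) : ℂ) * (Real.exp (-1 * x ^ 2) : ℝ)
      = (Real.exp (-1 / 2 * x ^ 2) : ℝ) := fun x => by
    rw [← ofReal_mul, ← Real.exp_add]
    congr 2
    ring
  have hd1 : ∀ x : ℝ, HasDerivAt (fun x : ℝ => ((Real.exp (1 / 2 * x ^ 2) : ℝ) : ℂ) * ζ x)
      (x * ((Real.exp (1 / 2 * x ^ 2) : ℝ) * ζ x) + (Real.exp (-1 / 2 * x ^ 2) : ℝ) * θ x) x := by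
    intro x
    convert! (hasDerivAt_gaussian (1 / 2) x).mul (hζ' x) using 1
    rw [← hexp]
    push_cast
    ring
  intro x
  rw [show _root_.deriv (fun x : ℝ => ((Real.exp (1 / 2 * x ^ 2) : ℝ) : ℂ) * ζ x) = _ from
    funext fun x => (hd1 x).deriv]
  have hd2 := ((hasDerivAt_id x).ofReal_comp.mul (hd1 x)).add
    ((hasDerivAt_gaussian (-1 / 2) x).mul (hθ' x))
  refine Eq.trans (congrArg (fun z => -z + _ + _) hd2.deriv) ?_
  simp only [id, ofReal_one]
  push_cast
  ring

/-- Test functions as a space of functions. -/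
def testFunctions : Submodule ℂ (ℝ → ℂ) where
  carrier := {φ | IsTest φ}
  zero_mem' := ⟨contDiff_const, HasCompactSupport.zero⟩
  add_mem' h h' := ⟨h.1.add h'.1, h.2.add h'.2⟩
  smul_mem' c _ h := h.mul (f := fun _ => c) contDiff_const

theorem integrable_locallyIntegrable_mul_test {f : ℝ → ℂ} (hf : LocallyIntegrable f volume)
    {φ : ℝ → ℂ} (h : IsTest φ) : Integrable (fun x => f x * φ x) :=
  (hf.integrable_smul_right_of_hasCompactSupport h.1.continuous h.2)

/-- The distribution defined by a locally integrable function. -/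
def distribution (f : ℝ → ℂ) (hf : LocallyIntegrable f volume) : testFunctions →ₗ[ℂ] ℂ where
  toFun φ := ∫ x, f x * (φ : ℝ → ℂ) x
  map_add' φ ψ := by
    rw [← integral_add (integrable_locallyIntegrable_mul_test hf φ.2)
      (integrable_locallyIntegrable_mul_test hf ψ.2)]
    simp [mul_add]
  map_smul' c φ := by
    rw [RingHom.id_apply, smul_eq_mul, ← integral_const_mul]
    simp [mul_left_comm]

/-- The weak equation is solved by duality, without regularity theory. If `χ` is killed by `1` and
by the error integral, `exp(-x²/2) χ` lies in the range of the operator, so the distribution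
`exp(-x²/2) u` kills `χ`. A functional vanishing on the common kernel of two others is in their
span. -/
theorem exists_ae_eq_of_inner_testN_eq_zero (u : H) (h : ∀ φ, ⟪(testN φ : H), u⟫ = 0) :
    ∃ c k : ℂ, ∀ᵐ x : ℝ, ((Real.exp (-1 / 2 * x ^ 2) : ℝ) : ℂ) * u x = c + k * (erfInt x : ℂ) := by
  have hv := locallyIntegrable_continuous_mul (contDiff_gaussian (-1 / 2)).continuous u
  have hone : LocallyIntegrable (fun _ : ℝ => (1 : ℂ)) volume := continuous_const.locallyIntegrable
  have hE : LocallyIntegrable (fun x => (erfInt x : ℂ)) volume :=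
    (continuous_ofReal.comp contDiff_erfInt.continuous).locallyIntegrable
  have hmem := mem_span_of_iInf_ker_le_ker
    (L := ![distribution _ hone, distribution _ hE]) (K := distribution _ hv) fun χ hχ => by
      rw [Submodule.mem_iInf] at hχ
      have h0 : ∫ x, (1 : ℂ) * (χ : ℝ → ℂ) x = 0 := hχ 0
      have h1 : ∫ x, (erfInt x : ℂ) * (χ : ℝ → ℂ) x = 0 := hχ 1
      simp only [one_mul] at h0
      have hχt : IsTest χ := χ.2
      obtain ⟨φ, hφ, hφe⟩ := hχt.conj.exists_harmonic_solution
        (by rw [integral_conj, h0, map_zero]) (by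
          have := congrArg conj h1
          rw [← integral_conj, map_zero] at this
          rw [← this]
          refine integral_congr_ae (Filter.Eventually.of_forall fun x => ?_)
          simp [mul_comm])
      obtain ⟨w, hw⟩ := hφ.exists_testSubmodule
      have h2 := h w
      rw [inner_eq_integral (testN_ae hφ hw)] at h2
      simp only [hφe] at h2
      rw [LinearMap.mem_ker]
      change ∫ x, _ = 0
      rw [← neg_eq_zero, ← integral_neg, ← h2]
      refine integral_congr_ae (Filter.Eventually.of_forall fun x => ?_)
      simp only [map_neg, map_mul, conj_ofReal, conj_conj]
      ring
  rw [Submodule.mem_span_range_iff_exists_fun] at hmem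
  obtain ⟨c, hc⟩ := hmem
  rw [Fin.sum_univ_two] at hc
  refine ⟨c 0, c 1, ?_⟩
  have hz := ae_eq_zero_of_integral_mul_test
    (hv.sub ((hone.smul (c 0)).add (hE.smul (c 1)))) fun χ hχ => by
      have h1 := LinearMap.congr_fun hc ⟨χ, hχ⟩
      have h2 : c 0 * (∫ x, (1 : ℂ) * χ x) + c 1 * ∫ x, (erfInt x : ℂ) * χ x
        = ∫ x, ((Real.exp (-1 / 2 * x ^ 2) : ℝ) : ℂ) * u x * χ x := h1
      have hi : Integrable fun x => c 0 * (1 * χ x) + c 1 * (erfInt x * χ x) :=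
        ((integrable_locallyIntegrable_mul_test hone hχ).const_mul _).add
          ((integrable_locallyIntegrable_mul_test hE hχ).const_mul _)
      rw [← integral_const_mul, ← integral_const_mul, ← integral_add
        ((integrable_locallyIntegrable_mul_test hone hχ).const_mul _)
        ((integrable_locallyIntegrable_mul_test hE hχ).const_mul _), eq_comm, ← sub_eq_zero,
        ← integral_sub (integrable_locallyIntegrable_mul_test hv hχ) hi] at h2
      rw [← h2]
      refine integral_congr_ae (Filter.Eventually.of_forall fun x => ?_)
      simp only [Pi.sub_apply, Pi.add_apply, Pi.smul_apply, smul_eq_mul]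
      ring
  filter_upwards [hz] with x hx
  simp only [Pi.sub_apply, Pi.add_apply, Pi.smul_apply, smul_eq_mul, mul_one, Pi.zero_apply] at hx
  exact sub_eq_zero.1 hx

/-- The Gaussian is at most `1`, so `|u|` dominates `|c + k erf|`. As the error integral is odd,
`|u(x)| + |u(-x)|` is at least `2|c|`, and at least `2|k| erf(1)` for `x ≥ 1`; a square integrable
function has no positive lower bound on a half-line. -/
theorem eq_zero_of_forall_inner_testN_eq_zero (u : H) (h : ∀ φ, ⟪(testN φ : H), u⟫ = 0) :
    u = 0 := by
  obtain ⟨c, k, hck⟩ := exists_ae_eq_of_inner_testN_eq_zero u h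
  have hmp := Measure.measurePreserving_neg (volume : Measure ℝ)
  have hle : ∀ᵐ x : ℝ, ‖c + k * (erfInt x : ℂ)‖ ≤ ‖u x‖ := by
    filter_upwards [hck] with x hx
    rw [← hx, norm_mul, norm_real, Real.norm_of_nonneg (Real.exp_pos _).le]
    refine mul_le_of_le_one_left (norm_nonneg _) (Real.exp_le_one_iff.2 ?_)
    nlinarith [sq_nonneg x]
  have hle' : ∀ᵐ x : ℝ, ‖c - k * (erfInt x : ℂ)‖ ≤ ‖u (-x)‖ := by
    filter_upwards [hmp.quasiMeasurePreserving.ae hle] with x hx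
    rw [erfInt_neg, ofReal_neg, mul_neg, ← sub_eq_add_neg] at hx
    exact hx
  have hw : MemLp (fun x => ‖u x‖ + ‖u (-x)‖) 2 volume :=
    (Lp.memLp u).norm.add ((Lp.memLp u).comp_measurePreserving hmp).norm
  have hzero : ∀ b : ℝ, (∀ x : ℝ, 1 ≤ x →
      b ≤ ‖c + k * (erfInt x : ℂ)‖ + ‖c - k * (erfInt x : ℂ)‖) → b ≤ 0 := by
    intro b hb
    by_contra! hb0
    have h1 := hw.meas_ge_lt_top (ε := b.toNNReal) (by simp) (by simp)
      (Real.toNNReal_pos.2 hb0).ne'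
    have h2 : volume (Set.Ici (1 : ℝ)) ≤ volume
        {x : ℝ | b.toNNReal ≤ ‖‖u x‖ + ‖u (-x)‖‖₊} := measure_mono_ae (by
      filter_upwards [hle, hle'] with x hx hx' h1x
      change b.toNNReal ≤ ‖‖u x‖ + ‖u (-x)‖‖₊
      rw [Real.toNNReal_le_iff_le_coe, coe_nnnorm, Real.norm_of_nonneg (by positivity)]
      exact (hb x h1x).trans (add_le_add hx hx'))
    rw [Real.volume_Ici] at h2
    exact absurd (lt_of_le_of_lt h2 h1) (lt_irrefl _)
  have hc : c = 0 := by
    have := hzero (2 * ‖c‖) fun x _ => by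
      have := norm_add_le (c + k * (erfInt x : ℂ)) (c - k * (erfInt x : ℂ))
      rwa [add_add_sub_cancel, ← two_mul, norm_mul, norm_ofNat] at this
    exact norm_le_zero_iff.1 (by linarith)
  have hk : k = 0 := by
    have := hzero (2 * (‖k‖ * erfInt 1)) fun x hx => by
      have h1 := norm_sub_le (c + k * (erfInt x : ℂ)) (c - k * (erfInt x : ℂ))
      rw [add_sub_sub_cancel, ← two_mul, norm_mul, norm_mul, norm_real, norm_ofNat] at h1
      have h2 := strictMono_erfInt.monotone hx
      have h3 := mul_le_mul_of_nonneg_left (h2.trans (le_abs_self _)) (norm_nonneg k)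
      rw [← Real.norm_eq_abs] at h3
      linarith
    have h1 : ‖k‖ * erfInt 1 ≤ 0 := by linarith
    exact norm_le_zero_iff.1 (nonpos_of_mul_nonpos_left h1 erfInt_one_pos)
  rw [Lp.eq_zero_iff_ae_eq_zero]
  filter_upwards [hck] with x hx
  rw [hc, hk, zero_mul, add_zero, mul_eq_zero] at hx
  exact hx.resolve_left (by exact_mod_cast (Real.exp_pos _).ne')

/-! ### Test functions are a core for the number operator -/

theorem mem_graph_of_mem {S : Op} {u : H} (h : u ∈ S.domain) : (u, S ⟨u, h⟩) ∈ S.graph :=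
  S.mem_graph ⟨u, h⟩

theorem exists_of_mem_graph {S : Op} {u w : H} (h : (u, w) ∈ S.graph) :
    ∃ hu : u ∈ S.domain, S ⟨u, hu⟩ = w := by
  rw [LinearPMap.mem_graph_iff] at h
  obtain ⟨y, hy, hw⟩ := h
  change (y : H) = u at hy
  subst hy
  exact ⟨y.2, hw⟩

theorem mem_graph_prodOp_iff {S T : Op} {u w : H} :
    (u, w) ∈ (prodOp S T).graph ↔ ∃ v, (u, v) ∈ T.graph ∧ (v, w) ∈ S.graph := by
  constructor
  · intro h
    obtain ⟨hu, rfl⟩ := exists_of_mem_graph h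
    obtain ⟨hT, hS⟩ := mem_prodOp_domain.1 hu
    exact ⟨T ⟨u, hT⟩, mem_graph_of_mem hT, mem_graph_of_mem hS⟩
  · rintro ⟨v, hv, hw⟩
    obtain ⟨hu, rfl⟩ := exists_of_mem_graph hv
    obtain ⟨hTu, rfl⟩ := exists_of_mem_graph hw
    exact mem_graph_of_mem (S := prodOp S T) (mem_prodOp_domain.2 ⟨hu, hTu⟩)

theorem mem_graph_add {S T : Op} {u v w : H} (hS : (u, v) ∈ S.graph) (hT : (u, w) ∈ T.graph) :
    (u, v + w) ∈ (S + T).graph := by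
  obtain ⟨h1, rfl⟩ := exists_of_mem_graph hS
  obtain ⟨h2, rfl⟩ := exists_of_mem_graph hT
  exact mem_graph_of_mem (S := S + T) ⟨h1, h2⟩

theorem testP_mem_graph (φ : testSubmodule) : ((φ : H), (testP φ : H)) ∈ p.graph :=
  mem_graph_of_mem (testSubmodule_le_domain_p φ.2)

theorem testQ_mem_graph (φ : testSubmodule) : ((φ : H), (testQ φ : H)) ∈ q.graph :=
  mem_graph_of_mem (testSubmodule_le_domain_q φ.2)

theorem testP_sq_mem_graph (φ : testSubmodule) : ((φ : H), (testP (testP φ) : H)) ∈ pSq.graph :=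
  mem_graph_prodOp_iff.2 ⟨_, testP_mem_graph _, testP_mem_graph _⟩

theorem testQ_sq_mem_graph (φ : testSubmodule) : ((φ : H), (testQ (testQ φ) : H)) ∈ qSq.graph :=
  mem_graph_prodOp_iff.2 ⟨_, testQ_mem_graph _, testQ_mem_graph _⟩

theorem inner_testP_testP_of_mem_graph {u w : H} (h : (u, w) ∈ pSq.graph) (φ : testSubmodule) :
    ⟪(testP (testP φ) : H), u⟫ = ⟪(φ : H), w⟫ := by
  obtain ⟨v, hv, hw⟩ := mem_graph_prodOp_iff.1 h
  rw [(mem_graph_p_iff _ _).1 hw, (mem_graph_p_iff _ _).1 hv]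

theorem inner_testQ_testQ_of_mem_graph {u w : H} (h : (u, w) ∈ qSq.graph) (φ : testSubmodule) :
    ⟪(testQ (testQ φ) : H), u⟫ = ⟪(φ : H), w⟫ := by
  obtain ⟨v, hv, hw⟩ := mem_graph_prodOp_iff.1 h
  rw [(mem_graph_q_iff _ _).1 hw, (mem_graph_q_iff _ _).1 hv]

theorem mem_graph_p_of_tendsto {φ : ℕ → testSubmodule} {u w : H}
    (hu : Tendsto (fun n => (φ n : H)) atTop (𝓝 u))
    (hw : Tendsto (fun n => (testP (φ n) : H)) atTop (𝓝 w)) : (u, w) ∈ p.graph := by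
  rw [mem_graph_p_iff]
  intro ψ
  refine tendsto_nhds_unique (tendsto_const_nhds.inner hw) ?_
  refine (tendsto_const_nhds.inner hu).congr fun n => ?_
  exact testP_isSymmetric ψ (φ n)

theorem mem_graph_q_of_tendsto {φ : ℕ → testSubmodule} {u w : H}
    (hu : Tendsto (fun n => (φ n : H)) atTop (𝓝 u))
    (hw : Tendsto (fun n => (testQ (φ n) : H)) atTop (𝓝 w)) : (u, w) ∈ q.graph := by
  rw [mem_graph_q_iff]
  intro ψ
  refine tendsto_nhds_unique (tendsto_const_nhds.inner hw) ?_
  refine (tendsto_const_nhds.inner hu).congr fun n => ?_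
  exact testQ_isSymmetric ψ (φ n)

/-- The quadruple `(φ, P² φ, Q² φ, (PQ + QP) φ)` for test functions `φ`. -/
def testTuple (φ : testSubmodule) : H × H × H × H :=
  (φ, testP (testP φ), testQ (testQ φ), testP (testQ φ) + testQ (testP φ))

theorem norm_testN_bounds (φ : testSubmodule) :
    ‖(φ : H)‖ ≤ ‖(testN φ : H)‖ ∧ ‖(testP (testP φ) : H)‖ ≤ ‖(testN φ : H)‖ ∧
      ‖(testQ (testQ φ) : H)‖ ≤ ‖(testN φ : H)‖ ∧ ‖(testQ (testP φ) : H)‖ ≤ ‖(testN φ : H)‖ ∧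
      ‖(testP (testQ φ) : H)‖ ≤ 2 * ‖(testN φ : H)‖ := by
  have h := sq_add_le_norm_shifted_harmonic_sq testP_isSymmetric testQ_isSymmetric
    testQ_testP_sub φ
  rw [← testN_apply] at h
  simp only [Submodule.coe_norm] at h
  have h1 : ‖(φ : H)‖ ≤ ‖(testN φ : H)‖ := by
    refine le_of_sq_le_sq ?_ (norm_nonneg _); nlinarith
  have h4 : ‖(testQ (testP φ) : H)‖ ≤ ‖(testN φ : H)‖ := by
    refine le_of_sq_le_sq ?_ (norm_nonneg _); nlinarith
  refine ⟨h1, ?_, ?_, h4, ?_⟩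
  · refine le_of_sq_le_sq ?_ (norm_nonneg _); nlinarith
  · refine le_of_sq_le_sq ?_ (norm_nonneg _); nlinarith
  · have e : (testP (testQ φ) : H) = testQ (testP φ) - I • (φ : H) := by
      have := congrArg (Subtype.val) (testQ_testP_sub φ)
      rw [Submodule.coe_sub, Submodule.coe_smul] at this
      rw [← this]; abel
    rw [e]
    refine (norm_sub_le _ _).trans ?_
    rw [norm_smul, norm_I]
    linarith

theorem norm_testP_le (φ : testSubmodule) : ‖(testP φ : H)‖ ≤ ‖(testN φ : H)‖ ∧
    ‖(testQ φ : H)‖ ≤ ‖(testN φ : H)‖ := by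
  have h1 := inner_harmonic_self testP_isSymmetric testQ_isSymmetric φ
  have h2 := norm_inner_le_norm (𝕜 := ℂ) φ (testP (testP φ) + testQ (testQ φ) + φ)
  have hs : ⟪φ, φ⟫ = ((‖φ‖ ^ 2 : ℝ) : ℂ) := inner_self_eq_norm_sq_complex φ
  rw [inner_add_right, h1, hs, ← ofReal_add, norm_real,
    Real.norm_of_nonneg (by positivity), ← testN_apply] at h2
  have h3 := (norm_testN_bounds φ).1
  simp only [Submodule.coe_norm] at h2
  constructor <;> refine le_of_sq_le_sq ?_ (norm_nonneg _) <;>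
    nlinarith [norm_nonneg (φ : H), sq_nonneg ‖(testP φ : H)‖, sq_nonneg ‖(testQ φ : H)‖]

theorem dense_range_testN : Dense (Set.range fun φ => (testN φ : H)) := by
  have h : (LinearMap.range (testSubmodule.subtype ∘ₗ testN)).topologicalClosure = ⊤ := by
    rw [Submodule.topologicalClosure_eq_top_iff, Submodule.eq_bot_iff]
    intro u hu
    refine eq_zero_of_forall_inner_testN_eq_zero u fun φ => ?_
    exact (Submodule.mem_orthogonal _ _).1 hu _ ⟨φ, rfl⟩
  exact Submodule.dense_iff_topologicalClosure_eq_top.2 h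

theorem exists_tendsto_of_norm_le_testN (K : testSubmodule →ₗ[ℂ] testSubmodule) (C : ℝ)
    (hK : ∀ φ, ‖(K φ : H)‖ ≤ C * ‖(testN φ : H)‖) {φ : ℕ → testSubmodule} {f : H}
    (hf : Tendsto (fun n => (testN (φ n) : H)) atTop (𝓝 f)) :
    ∃ g, Tendsto (fun n => (K (φ n) : H)) atTop (𝓝 g) :=
  exists_tendsto_of_norm_le (K := testSubmodule.subtype ∘ₗ K)
    (B := testSubmodule.subtype ∘ₗ testN) (C := C) hK hf

theorem exists_seq_testN_tendsto (f : H) :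
    ∃ φ : ℕ → testSubmodule, Tendsto (fun n => (testN (φ n) : H)) atTop (𝓝 f) := by
  obtain ⟨x, hx, hxf⟩ := mem_closure_iff_seq_limit.1 (dense_range_testN f)
  choose φ hφ using hx
  exact ⟨φ, hxf.congr fun n => (hφ n).symm⟩

/-- `p² + q² + 1` is onto, and the solutions can be approximated by test functions. -/
theorem exists_harmonic_eq (f : H) : ∃ u a b m : H, (u, a) ∈ pSq.graph ∧ (u, b) ∈ qSq.graph ∧
    (u, m) ∈ pqqp.graph ∧ a + b + u = f ∧ (u, a, b, m) ∈ closure (Set.range testTuple) := by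
  -- Every monomial of degree at most two in `P, Q` is bounded by `testN`, so all of them converge
  -- along `φ`; the weak characterizations of `p` and `q` identify the limits.
  obtain ⟨φ, hf⟩ := exists_seq_testN_tendsto f
  obtain ⟨u, hu⟩ : ∃ u, Tendsto (fun n => (φ n : H)) atTop (𝓝 u) :=
    exists_tendsto_of_norm_le_testN LinearMap.id 1
      (fun φ => (norm_testN_bounds φ).1.trans_eq (one_mul _).symm) hf
  obtain ⟨v, hv⟩ := exists_tendsto_of_norm_le_testN testP 1
    (fun φ => (norm_testP_le φ).1.trans_eq (one_mul _).symm) hf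
  obtain ⟨w, hw⟩ := exists_tendsto_of_norm_le_testN testQ 1
    (fun φ => (norm_testP_le φ).2.trans_eq (one_mul _).symm) hf
  obtain ⟨a, ha⟩ : ∃ a, Tendsto (fun n => (testP (testP (φ n)) : H)) atTop (𝓝 a) :=
    exists_tendsto_of_norm_le_testN (testP ∘ₗ testP) 1
      (fun φ => (norm_testN_bounds φ).2.1.trans_eq (one_mul _).symm) hf
  obtain ⟨b, hb⟩ : ∃ a, Tendsto (fun n => (testQ (testQ (φ n)) : H)) atTop (𝓝 a) :=
    exists_tendsto_of_norm_le_testN (testQ ∘ₗ testQ) 1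
      (fun φ => (norm_testN_bounds φ).2.2.1.trans_eq (one_mul _).symm) hf
  obtain ⟨m, hm⟩ : ∃ a, Tendsto (fun n => (testQ (testP (φ n)) : H)) atTop (𝓝 a) :=
    exists_tendsto_of_norm_le_testN (testQ ∘ₗ testP) 1
      (fun φ => (norm_testN_bounds φ).2.2.2.1.trans_eq (one_mul _).symm) hf
  obtain ⟨m', hm'⟩ : ∃ a, Tendsto (fun n => (testP (testQ (φ n)) : H)) atTop (𝓝 a) :=
    exists_tendsto_of_norm_le_testN (testP ∘ₗ testQ) 2
      (fun φ => (norm_testN_bounds φ).2.2.2.2) hf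
  have hpv : (u, v) ∈ p.graph := mem_graph_p_of_tendsto hu hv
  have hqw : (u, w) ∈ q.graph := mem_graph_q_of_tendsto hu hw
  have hva : (v, a) ∈ p.graph := mem_graph_p_of_tendsto hv ha
  have hwb : (w, b) ∈ q.graph := mem_graph_q_of_tendsto hw hb
  have hwm : (w, m') ∈ p.graph := mem_graph_p_of_tendsto hw hm'
  have hvm : (v, m) ∈ q.graph := mem_graph_q_of_tendsto hv hm
  have hf' : Tendsto (fun n => (testP (testP (φ n)) : H) + testQ (testQ (φ n)) + φ n) atTop
      (𝓝 f) := by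
    refine hf.congr fun n => ?_
    rw [testN_apply, Submodule.coe_add, Submodule.coe_add]
  have hsum : a + b + u = f := tendsto_nhds_unique ((ha.add hb).add hu) hf'
  have hcl : (u, a, b, m' + m) ∈ closure (Set.range testTuple) :=
    mem_closure_of_tendsto (hu.prodMk_nhds (ha.prodMk_nhds (hb.prodMk_nhds (hm'.add hm))))
      (Eventually.of_forall fun n => Set.mem_range_self (φ n))
  exact ⟨u, a, b, m' + m, mem_graph_prodOp_iff.2 ⟨v, hpv, hva⟩,
    mem_graph_prodOp_iff.2 ⟨w, hqw, hwb⟩,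
    mem_graph_add (mem_graph_prodOp_iff.2 ⟨w, hqw, hwm⟩) (mem_graph_prodOp_iff.2 ⟨v, hpv, hvm⟩),
    hsum, hcl⟩

/-- The vector `u` solves the same equation as an approximable solution, and the difference is
orthogonal to the range of `testN`, hence zero. Thus `pq + qp` is defined on all of `Dom N`, and
test functions are dense there in graph norm. -/
theorem exists_pqqp_of_mem_graph {u a b : H} (ha : (u, a) ∈ pSq.graph) (hb : (u, b) ∈ qSq.graph) :
    ∃ m, (u, m) ∈ pqqp.graph ∧ (u, a, b, m) ∈ closure (Set.range testTuple) := by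
  obtain ⟨v, a', b', m, ha', hb', hm, he, hc⟩ := exists_harmonic_eq (a + b + u)
  have huv : u - v = 0 := by
    refine eq_zero_of_forall_inner_testN_eq_zero _ fun φ => ?_
    have e : ∀ {u a b : H}, (u, a) ∈ pSq.graph → (u, b) ∈ qSq.graph →
        ⟪(testN φ : H), u⟫ = ⟪(φ : H), a + b + u⟫ := fun ha hb => by
      rw [testN_apply, Submodule.coe_add, Submodule.coe_add, inner_add_left, inner_add_left,
        inner_testP_testP_of_mem_graph ha, inner_testQ_testQ_of_mem_graph hb, inner_add_right,
        inner_add_right]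
    rw [inner_sub_right, e ha hb, e ha' hb', he, sub_self]
  obtain rfl := sub_eq_zero.1 huv
  obtain rfl := pSq.mem_graph_snd_inj ha ha' rfl
  obtain rfl := qSq.mem_graph_snd_inj hb hb' rfl
  exact ⟨m, hm, hc⟩

/-! ### The domain of the number operator -/

/-- The common domain of `p²` and `q²`. -/
abbrev domN : Submodule ℂ H := numberOp.domain

theorem domN_le_pSq : domN ≤ pSq.domain := fun _ h => h.1.1

theorem domN_le_qSq : domN ≤ qSq.domain := fun _ h => h.1.2

theorem domN_le_pqqp : domN ≤ pqqp.domain := fun _ h => by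
  obtain ⟨_, hm, -⟩ := exists_pqqp_of_mem_graph (mem_graph_of_mem (domN_le_pSq h))
    (mem_graph_of_mem (domN_le_qSq h))
  exact (exists_of_mem_graph hm).1

/-- `p²` on the domain of the number operator. -/
def domP2 : domN →ₗ[ℂ] H := pSq.toFun ∘ₗ Submodule.inclusion domN_le_pSq

/-- `q²` on the domain of the number operator. -/
def domQ2 : domN →ₗ[ℂ] H := qSq.toFun ∘ₗ Submodule.inclusion domN_le_qSq

/-- `pq + qp` on the domain of the number operator. -/
def domPQ : domN →ₗ[ℂ] H := pqqp.toFun ∘ₗ Submodule.inclusion domN_le_pqqp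

/-- `p² + q² + 1` on the domain of the number operator. -/
def domH : domN →ₗ[ℂ] H := domP2 + domQ2 + domN.subtype

theorem domH_apply (u : domN) : domH u = domP2 u + domQ2 u + (u : H) := rfl

theorem domP2_mem_graph (u : domN) : ((u : H), domP2 u) ∈ pSq.graph :=
  mem_graph_of_mem (domN_le_pSq u.2)

theorem domQ2_mem_graph (u : domN) : ((u : H), domQ2 u) ∈ qSq.graph :=
  mem_graph_of_mem (domN_le_qSq u.2)

theorem domPQ_mem_graph (u : domN) : ((u : H), domPQ u) ∈ pqqp.graph :=
  mem_graph_of_mem (domN_le_pqqp u.2)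

theorem dom_mem_closure (u : domN) :
    ((u : H), domP2 u, domQ2 u, domPQ u) ∈ closure (Set.range testTuple) := by
  obtain ⟨m, hm, hc⟩ := exists_pqqp_of_mem_graph (domP2_mem_graph u) (domQ2_mem_graph u)
  rwa [pqqp.mem_graph_snd_inj hm (domPQ_mem_graph u) rfl] at hc

/-- A closed condition that holds for test functions holds on the domain of the number operator. -/
theorem dom_induction {s : Set (H × H × H × H)} (hs : IsClosed s) (h : ∀ φ, testTuple φ ∈ s)
    (u : domN) : ((u : H), domP2 u, domQ2 u, domPQ u) ∈ s :=
  closure_minimal (Set.range_subset_iff.2 h) hs (dom_mem_closure u)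

theorem testSubmodule_le_domN : testSubmodule ≤ domN := fun u hu =>
  ⟨⟨(exists_of_mem_graph (testP_sq_mem_graph ⟨u, hu⟩)).1,
    (exists_of_mem_graph (testQ_sq_mem_graph ⟨u, hu⟩)).1⟩, trivial⟩

theorem dense_domN : Dense (domN : Set H) := by
  refine dense_range_testN.mono ?_
  rintro _ ⟨φ, rfl⟩
  exact testSubmodule_le_domN (testN φ).2

theorem dom_testTuple (φ : testSubmodule) (hφ : (φ : H) ∈ domN) :
    ((φ : H), domP2 ⟨φ, hφ⟩, domQ2 ⟨φ, hφ⟩, domPQ ⟨φ, hφ⟩) = testTuple φ := by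
  rw [testTuple, pSq.mem_graph_snd_inj (domP2_mem_graph ⟨φ, hφ⟩) (testP_sq_mem_graph φ) rfl,
    qSq.mem_graph_snd_inj (domQ2_mem_graph ⟨φ, hφ⟩) (testQ_sq_mem_graph φ) rfl,
    pqqp.mem_graph_snd_inj (domPQ_mem_graph ⟨φ, hφ⟩) (mem_graph_add
      (mem_graph_prodOp_iff.2 ⟨_, testQ_mem_graph _, testP_mem_graph _⟩)
      (mem_graph_prodOp_iff.2 ⟨_, testP_mem_graph _, testQ_mem_graph _⟩)) rfl]

theorem surjective_domH : Function.Surjective domH := fun f => by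
  obtain ⟨u, a, b, -, ha, hb, -, he, -⟩ := exists_harmonic_eq f
  obtain ⟨h1, rfl⟩ := exists_of_mem_graph ha
  obtain ⟨h2, rfl⟩ := exists_of_mem_graph hb
  exact ⟨⟨u, ⟨h1, h2⟩, trivial⟩, he⟩

theorem norm_le_norm_domH (u : domN) : ‖(u : H)‖ ≤ ‖domH u‖ ∧ ‖domP2 u‖ ≤ ‖domH u‖ ∧
    ‖domQ2 u‖ ≤ ‖domH u‖ ∧ ‖domPQ u‖ ≤ 3 * ‖domH u‖ := by
  have key : ∀ (i : H × H × H × H → H) (C : ℝ), Continuous i →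
      (∀ φ, ‖i (testTuple φ)‖ ≤ C * ‖(testN φ : H)‖) →
      ‖i ((u : H), domP2 u, domQ2 u, domPQ u)‖ ≤ C * ‖domH u‖ := fun i C hi h =>
    dom_induction (s := {z | ‖i z‖ ≤ C * ‖z.2.1 + z.2.2.1 + z.1‖})
      (isClosed_le (by fun_prop) (by fun_prop)) h u
  refine ⟨?_, ?_, ?_, ?_⟩
  · simpa using key (fun z => z.1) 1 (by fun_prop) fun φ => by
      simpa using! (norm_testN_bounds φ).1
  · simpa using key (fun z => z.2.1) 1 (by fun_prop) fun φ => by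
      simpa using! (norm_testN_bounds φ).2.1
  · simpa using key (fun z => z.2.2.1) 1 (by fun_prop) fun φ => by
      simpa using! (norm_testN_bounds φ).2.2.1
  · refine key (fun z => z.2.2.2) 3 (by fun_prop) fun φ => ?_
    obtain ⟨-, -, -, h4, h5⟩ := norm_testN_bounds φ
    refine (norm_add_le _ _).trans ?_
    linarith

theorem norm_sq_le_re_inner_domH (u : domN) : ‖(u : H)‖ ^ 2 ≤ (⟪domH u, (u : H)⟫).re := by
  refine dom_induction (s := {z | ‖z.1‖ ^ 2 ≤ (⟪z.2.1 + z.2.2.1 + z.1, z.1⟫).re}) ?_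
    (fun φ => ?_) u
  · exact isClosed_le (by fun_prop) (continuous_re.comp (by fun_prop))
  · have h1 := inner_harmonic_self testP_isSymmetric testQ_isSymmetric φ
    change ‖φ‖ ^ 2 ≤ (⟪testP (testP φ) + testQ (testQ φ) + φ, φ⟫).re
    have hs : ⟪φ, φ⟫ = ((‖φ‖ ^ 2 : ℝ) : ℂ) := inner_self_eq_norm_sq_complex φ
    rw [inner_add_left, ← inner_conj_symm, h1, conj_ofReal, hs, add_re,
      ofReal_re, ofReal_re]
    linarith [sq_nonneg ‖testP φ‖, sq_nonneg ‖testQ φ‖]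

/-- Symmetry needs checking only against test functions: the identity is a closed condition on the
second argument. -/
theorem inner_symm_of_testTuple (T : domN →ₗ[ℂ] H) (i : H × H × H × H → H) (hi : Continuous i)
    (hT : ∀ u, T u = i ((u : H), domP2 u, domQ2 u, domPQ u))
    (h : ∀ (u : domN) (φ : testSubmodule), ⟪T u, (φ : H)⟫ = ⟪(u : H), i (testTuple φ)⟫)
    (u v : domN) : ⟪T u, (v : H)⟫ = ⟪(u : H), T v⟫ := by
  rw [hT v]
  exact dom_induction (s := {z | ⟪T u, z.1⟫ = ⟪(u : H), i z⟫})
    (isClosed_eq (by fun_prop) (by fun_prop)) (h u) v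

theorem domP2_symm (u v : domN) : ⟪domP2 u, (v : H)⟫ = ⟪(u : H), domP2 v⟫ :=
  inner_symm_of_testTuple domP2 (fun z => z.2.1) (by fun_prop) (fun _ => rfl) (fun u φ => by
    rw [← inner_conj_symm, ← inner_testP_testP_of_mem_graph (domP2_mem_graph u), inner_conj_symm]
    rfl) u v

theorem domQ2_symm (u v : domN) : ⟪domQ2 u, (v : H)⟫ = ⟪(u : H), domQ2 v⟫ :=
  inner_symm_of_testTuple domQ2 (fun z => z.2.2.1) (by fun_prop) (fun _ => rfl) (fun u φ => by
    rw [← inner_conj_symm, ← inner_testQ_testQ_of_mem_graph (domQ2_mem_graph u), inner_conj_symm]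
    rfl) u v

theorem domPQ_symm (u v : domN) : ⟪domPQ u, (v : H)⟫ = ⟪(u : H), domPQ v⟫ := by
  refine inner_symm_of_testTuple domPQ (fun z => z.2.2.2) (by fun_prop) (fun _ => rfl)
    (fun u φ => ?_) u v
  -- Density is used again, now in the first argument; for two test functions the identity is the
  -- symmetry of `testP` and `testQ`.
  have h : ∀ ψ : testSubmodule, ⟪domPQ u, (ψ : H)⟫
      = ⟪(u : H), ((testP (testQ ψ) : H) + testQ (testP ψ))⟫ := by
    intro ψ
    refine (dom_induction (s := {z | ⟪z.2.2.2, (ψ : H)⟫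
      = ⟪z.1, ((testP (testQ ψ) : H) + testQ (testP ψ))⟫})
      (isClosed_eq (by fun_prop) (by fun_prop)) (fun φ => ?_) u :)
    change ⟪testP (testQ φ) + testQ (testP φ), ψ⟫ = ⟪φ, testP (testQ ψ) + testQ (testP ψ)⟫
    rw [inner_add_left, inner_add_right, testP_isSymmetric, testQ_isSymmetric, testQ_isSymmetric,
      testP_isSymmetric, add_comm]
  exact h φ

theorem exists_re_inner_dom_ge {a b c : ℂ} (ha : 0 < a.re) (hc : c.re ^ 2 < a.re * b.re) :
    ∃ ε : ℝ, 0 < ε ∧ ∃ C : ℝ, 0 ≤ C ∧ ∀ u : domN,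
      ε * ‖domP2 u + domQ2 u‖ ^ 2 - C * (‖(u : H)‖ ^ 2 + ‖(u : H)‖ * ‖domP2 u + domQ2 u‖)
        ≤ (⟪domP2 u + domQ2 u, a • domP2 u + b • domQ2 u + c • domPQ u⟫).re := by
  obtain ⟨ε, hε, C, hC, h⟩ := exists_re_inner_harmonic_quadMap_ge testP_isSymmetric
    testQ_isSymmetric testQ_testP_sub ha hc
  refine ⟨ε, hε, C, hC, fun u => ?_⟩
  refine dom_induction (s := {z | ε * ‖z.2.1 + z.2.2.1‖ ^ 2
    - C * (‖z.1‖ ^ 2 + ‖z.1‖ * ‖z.2.1 + z.2.2.1‖)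
    ≤ (⟪z.2.1 + z.2.2.1, a • z.2.1 + b • z.2.2.1 + c • z.2.2.2⟫).re}) ?_ (fun φ => h φ) u
  exact isClosed_le (by fun_prop) (continuous_re.comp (by fun_prop))

/-! ### Elliptic quadratic operators with a small perturbation -/

/-- `W` has relative bound zero with respect to the number operator. -/
def IsSmall (W : domN →ₗ[ℂ] H) : Prop :=
  ∀ ε : ℝ, 0 < ε → ∃ C : ℝ, ∀ u, ‖W u‖ ≤ ε * ‖domH u‖ + C * ‖(u : H)‖

theorem isSmall_zero : IsSmall 0 := fun ε hε => ⟨0, fun u => by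
  simp only [LinearMap.zero_apply, norm_zero]; positivity⟩

theorem isSmall_subtype : IsSmall domN.subtype := fun ε hε => ⟨1, fun u => by
  rw [one_mul]; exact le_add_of_nonneg_left (by positivity)⟩

theorem IsSmall.add {W W' : domN →ₗ[ℂ] H} (h : IsSmall W) (h' : IsSmall W') :
    IsSmall (W + W') := fun ε hε => by
  obtain ⟨C, hC⟩ := h (ε / 2) (half_pos hε)
  obtain ⟨C', hC'⟩ := h' (ε / 2) (half_pos hε)
  refine ⟨C + C', fun u => (norm_add_le _ _).trans ?_⟩
  linarith [hC u, hC' u]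

theorem IsSmall.smul {W : domN →ₗ[ℂ] H} (h : IsSmall W) (c : ℂ) : IsSmall (c • W) :=
    fun ε hε => by
  have hc : 0 < ‖c‖ + 1 := by positivity
  obtain ⟨C, hC⟩ := h (ε / (‖c‖ + 1)) (div_pos hε hc)
  refine ⟨‖c‖ * C, fun u => ?_⟩
  rw [LinearMap.smul_apply, norm_smul]
  have h1 := mul_le_mul_of_nonneg_left (hC u) (norm_nonneg c)
  have h2 : ‖c‖ * (ε / (‖c‖ + 1)) ≤ ε := by
    rw [mul_div_assoc', div_le_iff₀ hc]; nlinarith [norm_nonneg c]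
  nlinarith [mul_le_mul_of_nonneg_right h2 (norm_nonneg (domH u))]

/-- `a p² + b q² + c (pq + qp) + W` on the domain of the number operator. -/
def quadDom (a b c : ℂ) (W : domN →ₗ[ℂ] H) : domN →ₗ[ℂ] H :=
  a • domP2 + b • domQ2 + c • domPQ + W

theorem quadDom_apply (a b c : ℂ) (W : domN →ₗ[ℂ] H) (u : domN) :
    quadDom a b c W u = a • domP2 u + b • domQ2 u + c • domPQ u + W u := rfl

theorem smul_quadDom (κ a b c : ℂ) (W : domN →ₗ[ℂ] H) :
    κ • quadDom a b c W = quadDom (κ * a) (κ * b) (κ * c) (κ • W) := by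
  simp only [quadDom, smul_add, mul_smul]

theorem norm_quadratic_le (a b c : ℂ) (u : domN) :
    ‖a • domP2 u + b • domQ2 u + c • domPQ u‖ ≤ (‖a‖ + ‖b‖ + 3 * ‖c‖) * ‖domH u‖ := by
  obtain ⟨-, h2, h3, h4⟩ := norm_le_norm_domH u
  refine (norm_add₃_le).trans ?_
  rw [norm_smul, norm_smul, norm_smul]
  nlinarith [mul_le_mul_of_nonneg_left h2 (norm_nonneg a),
    mul_le_mul_of_nonneg_left h3 (norm_nonneg b), mul_le_mul_of_nonneg_left h4 (norm_nonneg c)]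

theorem exists_norm_quadDom_le (a b c : ℂ) {W : domN →ₗ[ℂ] H} (hW : IsSmall W) :
    ∃ C : ℝ, 0 ≤ C ∧ ∀ u, ‖quadDom a b c W u‖ ≤ C * ‖domH u‖ := by
  obtain ⟨C, hC⟩ := hW 1 one_pos
  refine ⟨‖a‖ + ‖b‖ + 3 * ‖c‖ + (1 + |C|), by positivity, fun u => ?_⟩
  rw [quadDom_apply]
  refine (norm_add_le _ _).trans ?_
  have h1 := mul_le_mul (le_abs_self C) (norm_le_norm_domH u).1 (norm_nonneg _) (abs_nonneg _)
  have h2 := norm_quadratic_le a b c u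
  have h3 := hC u
  rw [add_mul _ (1 + |C|)]
  linarith

/-- The shifted operator is coercive with respect to `p² + q² + 1`. -/
theorem exists_coercive {a b c : ℂ} (ha : 0 < a.re) (hc : c.re ^ 2 < a.re * b.re)
    {W : domN →ₗ[ℂ] H} (hW : IsSmall W) :
    ∃ δ : ℝ, 0 < δ ∧ ∃ μ₀ : ℝ, ∀ μ : ℝ, μ₀ ≤ μ → ∀ u,
      δ * ‖domH u‖ ^ 2 ≤ (⟪domH u, quadDom a b c W u + (μ : ℂ) • (u : H)⟫).re := by
  obtain ⟨ε, hε, C, hC, hG⟩ := exists_re_inner_dom_ge ha hc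
  obtain ⟨C', hC'⟩ := hW (ε / 2) (half_pos hε)
  set K := ‖a‖ + ‖b‖ + 3 * ‖c‖ with hK
  -- `B` collects the coefficients of all mixed terms `‖domH u‖ ‖u‖`. Of the leading `ε`, the
  -- perturbation costs `ε/2` and Young's inequality for the mixed terms `ε/4`; the shift pays for
  -- the `‖u‖²` terms.
  set B := 2 * ε + 2 * C + K + |C'| with hB
  have hK0 : 0 ≤ K := by positivity
  have hB0 : 0 ≤ B := by positivity
  refine ⟨ε / 4, by positivity, B ^ 2 / ε + C, fun μ hμ u => ?_⟩
  set A := a • domP2 u + b • domQ2 u + c • domPQ u with hA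
  have e : (⟪domH u, quadDom a b c W u + (μ : ℂ) • (u : H)⟫).re
      = (⟪domP2 u + domQ2 u, A⟫).re + (⟪(u : H), A⟫).re + (⟪domH u, W u⟫).re
        + μ * (⟪domH u, (u : H)⟫).re := by
    rw [quadDom_apply, inner_add_right, inner_add_right, inner_smul_right]
    nth_rewrite 1 [domH_apply]
    rw [inner_add_left]
    simp only [add_re, re_ofReal_mul]
    rfl
  have h1 := hG u
  have h2 : -(‖(u : H)‖ * (K * ‖domH u‖)) ≤ (⟪(u : H), A⟫).re := by
    have := (abs_re_le_norm ⟪(u : H), A⟫).trans (norm_inner_le_norm _ _)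
    have h' := mul_le_mul_of_nonneg_left (norm_quadratic_le a b c u) (norm_nonneg (u : H))
    exact (neg_le_neg (this.trans h')).trans (neg_abs_le _)
  have h3 : -(‖domH u‖ * (ε / 2 * ‖domH u‖ + |C'| * ‖(u : H)‖)) ≤ (⟪domH u, W u⟫).re := by
    have := (abs_re_le_norm ⟪domH u, W u⟫).trans (norm_inner_le_norm _ _)
    have h' := mul_le_mul_of_nonneg_left ((hC' u).trans
      (add_le_add_right (mul_le_mul_of_nonneg_right (le_abs_self C') (norm_nonneg (u : H))) _))
      (norm_nonneg (domH u))
    exact (neg_le_neg (this.trans h')).trans (neg_abs_le _)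
  have hμ0 : 0 ≤ μ := le_trans (by positivity) hμ
  have h4 : (B ^ 2 / ε + C) * ‖(u : H)‖ ^ 2 ≤ μ * (⟪domH u, (u : H)⟫).re :=
    mul_le_mul hμ (norm_sq_le_re_inner_domH u) (by positivity) hμ0
  have ht := (norm_le_norm_domH u).1
  have hn0 : domP2 u + domQ2 u = domH u - (u : H) := by rw [domH_apply, add_sub_cancel_right]
  have h5 : ‖domP2 u + domQ2 u‖ ≤ ‖domH u‖ + ‖(u : H)‖ := hn0 ▸ norm_sub_le _ _
  have h6 : ‖domH u‖ - ‖(u : H)‖ ≤ ‖domP2 u + domQ2 u‖ := hn0 ▸ norm_sub_norm_le _ _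
  rw [e]
  set n := ‖domH u‖
  set t := ‖(u : H)‖
  have ht0 : 0 ≤ t := norm_nonneg _
  have h7 : ε * (n ^ 2 - 2 * (n * t)) ≤ ε * ‖domP2 u + domQ2 u‖ ^ 2 := by
    refine mul_le_mul_of_nonneg_left ?_ hε.le
    have := pow_le_pow_left₀ (sub_nonneg.2 ht) h6 2
    nlinarith
  have h8 : C * (t * ‖domP2 u + domQ2 u‖) ≤ C * (2 * (n * t)) := by
    refine mul_le_mul_of_nonneg_left ?_ hC
    nlinarith [mul_le_mul_of_nonneg_left h5 ht0, mul_le_mul_of_nonneg_left ht ht0]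
  have h9 : B * (n * t) ≤ ε / 4 * n ^ 2 + B ^ 2 / ε * t ^ 2 := by
    have : ε / 4 * n ^ 2 + B ^ 2 / ε * t ^ 2 - B * (n * t) = (ε * n / 2 - B * t) ^ 2 / ε := by
      field_simp
      ring
    have h' : 0 ≤ (ε * n / 2 - B * t) ^ 2 / ε := by positivity
    linarith
  have h10 : B * (n * t) = 2 * ε * (n * t) + 2 * C * (n * t) + K * (n * t) + |C'| * (n * t) := by
    rw [hB]; ring
  nlinarith

theorem surjective_quadDom_add {a b c κ : ℂ} (ha : 0 < (κ * a).re)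
    (hc : (κ * c).re ^ 2 < (κ * a).re * (κ * b).re) {W : domN →ₗ[ℂ] H} (hW : IsSmall W) :
    ∃ μ₀ : ℝ, ∀ μ : ℝ, μ₀ ≤ μ → ∀ f : H,
      ∃ u : domN, κ • quadDom a b c W u + (μ : ℂ) • (u : H) = f := by
  obtain ⟨δ, hδ, μ₀, hco⟩ := exists_coercive ha hc (hW.smul κ)
  refine ⟨μ₀, fun μ hμ => ?_⟩
  obtain ⟨C, -, hC⟩ := exists_norm_quadDom_le (κ * a) (κ * b) (κ * c)
    ((hW.smul κ).add (isSmall_subtype.smul μ))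
  have h := surjective_of_coercive surjective_domH hδ hC fun u => by
    have := hco μ hμ u
    rw [quadDom_apply, add_assoc] at this
    exact this
  intro f
  obtain ⟨u, hu⟩ := h f
  refine ⟨u, ?_⟩
  rw [← hu, ← LinearMap.smul_apply, smul_quadDom, quadDom_apply, quadDom_apply, add_assoc]
  rfl

/-- The elliptic estimate: Cauchy-Schwarz in the coercivity bound, divided by `‖domH u‖`. -/
theorem exists_norm_domH_le {a b c κ : ℂ} (ha : 0 < (κ * a).re)
    (hc : (κ * c).re ^ 2 < (κ * a).re * (κ * b).re) {W : domN →ₗ[ℂ] H} (hW : IsSmall W) :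
    ∃ C : ℝ, 0 ≤ C ∧ ∀ u, ‖domH u‖ ≤ C * (‖quadDom a b c W u‖ + ‖(u : H)‖) := by
  obtain ⟨δ, hδ, μ, hco⟩ := exists_coercive ha hc (hW.smul κ)
  refine ⟨(‖κ‖ + |μ|) / δ, by positivity, fun u => ?_⟩
  have h1 := hco μ le_rfl u
  rw [← smul_quadDom, LinearMap.smul_apply] at h1
  have h2 : ‖κ • quadDom a b c W u + (μ : ℂ) • (u : H)‖
      ≤ (‖κ‖ + |μ|) * (‖quadDom a b c W u‖ + ‖(u : H)‖) := by
    refine (norm_add_le _ _).trans ?_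
    rw [norm_smul, norm_smul, norm_real, Real.norm_eq_abs]
    nlinarith [mul_nonneg (norm_nonneg κ) (norm_nonneg (u : H)),
      mul_nonneg (abs_nonneg μ) (norm_nonneg (quadDom a b c W u))]
  have h3 := (re_le_norm _).trans
    (norm_inner_le_norm (𝕜 := ℂ) (domH u) (κ • quadDom a b c W u + (μ : ℂ) • (u : H)))
  have h4 : δ * ‖domH u‖ ≤ (‖κ‖ + |μ|) * (‖quadDom a b c W u‖ + ‖(u : H)‖) := by
    rcases (norm_nonneg (domH u)).eq_or_lt with h0 | h0
    · rw [← h0, mul_zero]; positivity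
    · have h5 := mul_le_mul_of_nonneg_left h2 h0.le
      refine le_of_mul_le_mul_left ?_ h0
      nlinarith
  rw [div_mul_eq_mul_div, le_div_iff₀ hδ]
  linarith

/-- The operator on the domain of the number operator given by a linear map. -/
def domOp (T : domN →ₗ[ℂ] H) : Op := ⟨domN, T⟩

theorem re_star_mul_conj (κ z : ℂ) : (star κ * conj z).re = (κ * z).re := by simp

/-- Ellipticity for `κ` is inherited by the conjugate coefficients with `star κ`, so one large real
shift makes both operators onto. -/
theorem adjoint_domOp_quadDom {a b c κ : ℂ} (ha : 0 < (κ * a).re)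
    (hc : (κ * c).re ^ 2 < (κ * a).re * (κ * b).re) {W W' : domN →ₗ[ℂ] H} (hW : IsSmall W)
    (hW' : IsSmall W') (hWW' : ∀ u v : domN, ⟪W' u, (v : H)⟫ = ⟪(u : H), W v⟫) :
    (domOp (quadDom a b c W))† = domOp (quadDom (conj a) (conj b) (conj c) W') := by
  obtain ⟨μ₁, h1⟩ := surjective_quadDom_add ha hc hW
  obtain ⟨μ₂, h2⟩ := surjective_quadDom_add (a := conj a) (b := conj b) (c := conj c)
    (κ := star κ) (by rwa [re_star_mul_conj]) (by simpa only [re_star_mul_conj]) hW'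
  refine adjoint_eq_of_surjective dense_domN ?_ κ ((max μ₁ μ₂ : ℝ) : ℂ)
    (h1 _ (le_max_left _ _)) ?_
  · have key : ∀ u v : domN,
        ⟪quadDom (conj a) (conj b) (conj c) W' u, (v : H)⟫ = ⟪(u : H), quadDom a b c W v⟫ := by
      intro u v
      simp only [quadDom_apply, inner_add_left, inner_add_right, inner_smul_left,
        inner_smul_right, conj_conj, domP2_symm, domQ2_symm, domPQ_symm, hWW']
    exact LinearPMap.IsFormalAdjoint.symm fun u v => key u v
  · rw [star_def, conj_ofReal]
    exact h2 _ (le_max_right _ _)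

/-- The operator is the adjoint of its own formal adjoint, and adjoints are closed. -/
theorem isClosed_domOp_quadDom {a b c κ : ℂ} (ha : 0 < (κ * a).re)
    (hc : (κ * c).re ^ 2 < (κ * a).re * (κ * b).re) {W W' : domN →ₗ[ℂ] H} (hW : IsSmall W)
    (hW' : IsSmall W') (hWW' : ∀ u v : domN, ⟪W' u, (v : H)⟫ = ⟪(u : H), W v⟫) :
    (domOp (quadDom a b c W)).IsClosed := by
  have h := adjoint_domOp_quadDom (a := conj a) (b := conj b) (c := conj c)
    (κ := star κ) (by rwa [re_star_mul_conj]) (by simpa only [re_star_mul_conj]) hW' hW fun u v => by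
      rw [← inner_conj_symm, ← hWW', inner_conj_symm]
  simp only [conj_conj] at h
  rw [← h]
  exact LinearPMap.adjoint_isClosed dense_domN

theorem closure_eq_self_of_isClosed {S : Op} (h : S.IsClosed) : S.closure = S := by
  refine LinearPMap.eq_of_eq_graph ?_
  rw [← h.isClosable.graph_closure_eq_closure_graph]
  exact h.submodule_topologicalClosure_eq

/-- Test functions are a core for elliptic quadratic operators. -/
theorem closure_domRestrict_domOp {a b c : ℂ}
    (h : (domOp (quadDom a b c 0)).IsClosed) :
    ((domOp (quadDom a b c 0)).domRestrict testSubmodule).closure = domOp (quadDom a b c 0) := by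
  set X := domOp (quadDom a b c 0) with hX
  have hle : X.domRestrict testSubmodule ≤ X := LinearPMap.domRestrict_le
  have hcl := h.isClosable.leIsClosable hle
  refine LinearPMap.eq_of_eq_graph ?_
  rw [← hcl.graph_closure_eq_closure_graph]
  refine le_antisymm ?_ ?_
  · exact Submodule.topologicalClosure_minimal _ (LinearPMap.le_graph_of_le hle) h
  · rintro ⟨u, w⟩ huw
    obtain ⟨hu, rfl⟩ := exists_of_mem_graph huw
    have key := dom_induction (s := {z | (z.1, a • z.2.1 + b • z.2.2.1 + c • z.2.2.2 + 0) ∈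
      (X.domRestrict testSubmodule).graph.topologicalClosure})
      ((Submodule.isClosed_topologicalClosure _).preimage (by fun_prop)) (fun φ => ?_) ⟨u, hu⟩
    · exact key
    · refine Submodule.le_topologicalClosure _ ?_
      rw [← dom_testTuple φ (testSubmodule_le_domN φ.2)]
      exact mem_graph_of_mem (S := X.domRestrict testSubmodule) ⟨φ.2, testSubmodule_le_domN φ.2⟩

/-! ### Graph norms -/

theorem graphNorm_domOp_le {S T : domN →ₗ[ℂ] H} {C : ℝ}
    (h : ∀ u, ‖S u‖ ≤ C * (‖T u‖ + ‖(u : H)‖)) (u : domN) :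
    graphNorm (domOp S) u ≤ Real.sqrt (2 * C ^ 2 + 1) * graphNorm (domOp T) u := by
  have h1 := pow_le_pow_left₀ (norm_nonneg _) (h u) 2
  change Real.sqrt (‖S u‖ ^ 2 + ‖(u : H)‖ ^ 2)
    ≤ Real.sqrt (2 * C ^ 2 + 1) * Real.sqrt (‖T u‖ ^ 2 + ‖(u : H)‖ ^ 2)
  rw [← Real.sqrt_mul (by positivity)]
  refine Real.sqrt_le_sqrt ?_
  nlinarith [mul_nonneg (sq_nonneg C) (sq_nonneg (‖T u‖ - ‖(u : H)‖)), sq_nonneg ‖T u‖]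

/-- The graph norm of `T` is equivalent to that of `p² + q² + 1`. -/
def EquivHarmonic (T : domN →ₗ[ℂ] H) : Prop :=
  ∃ C : ℝ, 0 ≤ C ∧ ∀ u, ‖T u‖ ≤ C * ‖domH u‖ ∧ ‖domH u‖ ≤ C * (‖T u‖ + ‖(u : H)‖)

theorem EquivHarmonic.exists_norm_le {S T : domN →ₗ[ℂ] H} (hS : EquivHarmonic S)
    (hT : EquivHarmonic T) : ∃ C : ℝ, 0 ≤ C ∧ ∀ u, ‖S u‖ ≤ C * (‖T u‖ + ‖(u : H)‖) := by
  obtain ⟨C, hC, h⟩ := hS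
  obtain ⟨C', hC', h'⟩ := hT
  refine ⟨C * C', mul_nonneg hC hC', fun u => (h u).1.trans ?_⟩
  rw [mul_assoc]
  exact mul_le_mul_of_nonneg_left (h' u).2 hC

theorem EquivHarmonic.equivGraphNorms {S T : domN →ₗ[ℂ] H} (hS : EquivHarmonic S)
    (hT : EquivHarmonic T) : EquivGraphNorms (domOp S) (domOp T) := by
  obtain ⟨C, -, h⟩ := hS.exists_norm_le hT
  obtain ⟨C', -, h'⟩ := hT.exists_norm_le hS
  refine ⟨rfl, (Real.sqrt (2 * C ^ 2 + 1))⁻¹, Real.sqrt (2 * C' ^ 2 + 1), by positivity,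
    by positivity, fun u v huv => ?_⟩
  obtain rfl : u = v := Subtype.ext huv
  refine ⟨?_, graphNorm_domOp_le h' u⟩
  rw [inv_mul_le_iff₀ (by positivity)]
  exact graphNorm_domOp_le h u

theorem EquivHarmonic.relativelyBounded {S T : domN →ₗ[ℂ] H} (hS : EquivHarmonic S)
    (hT : EquivHarmonic T) : RelativelyBounded (domOp S) (domOp T) := by
  obtain ⟨C, hC, h⟩ := hS.exists_norm_le hT
  refine ⟨le_rfl, C, C, hC, hC, fun u v huv => ?_⟩
  obtain rfl : u = v := Subtype.ext huv
  exact (h u).trans_eq (mul_add _ _ _)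

theorem equivHarmonic_quadDom {a b c κ : ℂ} (ha : 0 < (κ * a).re)
    (hc : (κ * c).re ^ 2 < (κ * a).re * (κ * b).re) {W : domN →ₗ[ℂ] H} (hW : IsSmall W) :
    EquivHarmonic (quadDom a b c W) := by
  obtain ⟨C, hC, h⟩ := exists_norm_quadDom_le a b c hW
  obtain ⟨C', hC', h'⟩ := exists_norm_domH_le ha hc hW
  exact ⟨max C C', le_max_of_le_left hC, fun u =>
    ⟨(h u).trans (mul_le_mul_of_nonneg_right (le_max_left _ _) (norm_nonneg _)),
    (h' u).trans (mul_le_mul_of_nonneg_right (le_max_right _ _) (by positivity))⟩⟩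

theorem numberOp_eq : numberOp = domOp ((1 / 2 : ℂ) • (domP2 + domQ2 - domN.subtype)) := rfl

theorem equivHarmonic_number :
    EquivHarmonic ((1 / 2 : ℂ) • (domP2 + domQ2 - domN.subtype)) := by
  refine ⟨2, two_pos.le, fun u => ?_⟩
  set z := ((1 / 2 : ℂ) • (domP2 + domQ2 - domN.subtype)) u with hz
  have e : domH u = (2 : ℂ) • (z + (u : H)) := by
    rw [hz, domH_apply]
    simp only [LinearMap.smul_apply, LinearMap.sub_apply, LinearMap.add_apply,
      Submodule.subtype_apply]
    module
  have e' : z = (1 / 2 : ℂ) • domH u - (u : H) := by rw [e]; module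
  constructor
  · rw [e']
    refine (norm_sub_le _ _).trans ?_
    rw [norm_smul]
    norm_num
    linarith [(norm_le_norm_domH u).1, norm_nonneg (domH u)]
  · rw [e, norm_smul, norm_ofNat]
    exact mul_le_mul_of_nonneg_left (norm_add_le _ _) two_pos.le

/-! ### The potential -/

theorem domQ2_ae (u : domN) : domQ2 u =ᵐ[volume] fun x => (x : ℂ) * ((x : ℂ) * (u : H) x) := by
  obtain ⟨v, hv, hw⟩ := mem_graph_prodOp_iff.1 (domQ2_mem_graph u)
  obtain ⟨h1, h1'⟩ := exists_of_mem_graph hv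
  obtain ⟨h2, h2'⟩ := exists_of_mem_graph hw
  have h3 : q ⟨u, h1⟩ =ᵐ[volume] _ := mulOp_apply_ae _ _
  have h4 : q ⟨v, h2⟩ =ᵐ[volume] _ := mulOp_apply_ae _ _
  rw [h1'] at h3
  rw [h2'] at h4
  filter_upwards [h3, h4] with x h3 h4
  rw [h4, ← h3]

theorem mulOp_symm (V : ℝ → ℝ) (u v : (mulOp V).domain) :
    ⟪mulOp V u, (v : H)⟫ = ⟪(u : H), mulOp V v⟫ := by
  rw [inner_eq_integral (mulOp_apply_ae V u), inner_eq_integral (EventuallyEq.refl _ _)]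
  refine integral_congr_ae ?_
  filter_upwards [mulOp_apply_ae V v] with x hx
  rw [hx, map_mul, conj_ofReal]
  ring

theorem norm_mul_le_of_le {V : ℝ → ℝ} {ε C : ℝ} (hVb : ∀ x, |V x| ≤ ε * x ^ 2 + C) (u : domN) :
    ∀ᵐ x, ‖(V x : ℂ) * (u : H) x‖ ≤ ε * ‖domQ2 u x‖ + C * ‖(u : H) x‖ := by
  filter_upwards [domQ2_ae u] with x hx
  rw [hx, norm_mul, norm_mul, norm_mul, norm_real, norm_real, Real.norm_eq_abs, Real.norm_eq_abs,
    ← mul_assoc |x|, abs_mul_abs_self, ← mul_assoc, ← add_mul, ← pow_two]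
  exact mul_le_mul_of_nonneg_right (hVb x) (norm_nonneg _)

theorem domN_le_mulOp {V : ℝ → ℝ} (hV : Continuous V) {ε C : ℝ}
    (hVb : ∀ x, |V x| ≤ ε * x ^ 2 + C) : domN ≤ (mulOp V).domain := fun u hu => by
  have hg : MemLp (fun x => ε * ‖domQ2 ⟨u, hu⟩ x‖ + C * ‖u x‖) 2 volume :=
    ((Lp.memLp _).norm.const_mul ε).add ((Lp.memLp u).norm.const_mul C)
  refine hg.of_le ((continuous_ofReal.comp hV).aestronglyMeasurable.mul
    (Lp.aestronglyMeasurable u)) ?_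
  filter_upwards [norm_mul_le_of_le hVb ⟨u, hu⟩] with x hx
  exact hx.trans (le_abs_self _)

/-- Multiplication by `V` on the domain of the number operator. -/
def domMul (V : ℝ → ℝ) (h : domN ≤ (mulOp V).domain) : domN →ₗ[ℂ] H :=
  (mulOp V).toFun ∘ₗ Submodule.inclusion h

theorem norm_domMul_le {V : ℝ → ℝ} (h : domN ≤ (mulOp V).domain) {ε C : ℝ} (hε : 0 ≤ ε)
    (hC : 0 ≤ C) (hVb : ∀ x, |V x| ≤ ε * x ^ 2 + C) (u : domN) :
    ‖domMul V h u‖ ≤ ε * ‖domQ2 u‖ + C * ‖(u : H)‖ := by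
  -- Moduli are taken as elements of real `L²`, where the pointwise bound becomes a norm bound and
  -- the triangle inequality applies.
  have hn : ∀ w : H, ∃ W : Lp ℝ 2 (volume : Measure ℝ), ‖W‖ = ‖w‖ ∧
      W =ᵐ[volume] fun x => ‖w x‖ := fun w => by
    refine ⟨(Lp.memLp w).norm.toLp _, ?_, MemLp.coeFn_toLp _⟩
    rw [Lp.norm_toLp, eLpNorm_norm, Lp.norm_def]
  obtain ⟨A, hA, hA'⟩ := hn (domQ2 u)
  obtain ⟨B, hB, hB'⟩ := hn u
  have h1 : ‖domMul V h u‖ ≤ ‖ε • A + C • B‖ := by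
    refine Lp.norm_le_norm_of_ae_le ?_
    filter_upwards [norm_mul_le_of_le hVb u, mulOp_apply_ae V ⟨u, h u.2⟩, hA', hB',
      Lp.coeFn_add (ε • A) (C • B), Lp.coeFn_smul ε A, Lp.coeFn_smul C B] with x h1 h2 h3 h4 h5 h6 h7
    rw [h5, Pi.add_apply, h6, h7, Pi.smul_apply, Pi.smul_apply, h3, h4]
    change ‖mulOp V ⟨u, h u.2⟩ x‖ ≤ _
    rw [h2]
    exact h1.trans (le_abs_self _)
  refine h1.trans ((norm_add_le _ _).trans ?_)
  rw [norm_smul, norm_smul, hA, hB, Real.norm_of_nonneg hε, Real.norm_of_nonneg hC]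

theorem isSmall_domMul {V : ℝ → ℝ} (h : domN ≤ (mulOp V).domain)
    (hV : ∀ ε : ℝ, 0 < ε → ∃ C : ℝ, 0 ≤ C ∧ ∀ x, |V x| ≤ ε * x ^ 2 + C) :
    IsSmall (domMul V h) := fun ε hε => by
  obtain ⟨C, hC, hVb⟩ := hV ε hε
  refine ⟨C, fun u => (norm_domMul_le h hε.le hC hVb u).trans ?_⟩
  have := mul_le_mul_of_nonneg_left (norm_le_norm_domH u).2.2.1 hε.le
  linarith

/-- A function whose derivative grows sublinearly is `o(x²)`. -/
theorem exists_abs_le_of_deriv_growth {V : ℝ → ℝ} (hV : Differentiable ℝ V) {g α : ℝ}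
    (hg : 0 < g) (hα0 : 0 ≤ α) (hα1 : α < 1)
    (h : ∀ x : ℝ, |deriv V x| ≤ g * (1 + |x| ^ 2) ^ (α / 2)) {ε : ℝ} (hε : 0 < ε) :
    ∃ C : ℝ, 0 ≤ C ∧ ∀ x, |V x| ≤ ε * x ^ 2 + C := by
  -- With this slope, `y^α ≤ ε/(2g) y + const` bounds the derivative by `ε/2 |x| + B`. The mean
  -- value inequality gives `ε/2 x² + B|x|`, and Young's inequality spends the other `ε/2` on
  -- `B|x|`.
  have hδ : 0 < ε / (2 * g) := by positivity
  obtain ⟨Y, hY⟩ := Filter.eventually_atTop.1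
    (((tendsto_rpow_neg_atTop (sub_pos.2 hα1)).eventually_le_const hδ).and
      (eventually_gt_atTop (0 : ℝ)))
  set Z := max Y 0 with hZ
  have hZ0 : 0 ≤ Z := le_max_right _ _
  have hpow : ∀ y : ℝ, 0 ≤ y → y ^ α ≤ ε / (2 * g) * y + Z ^ α := by
    intro y hy
    rcases le_total Y y with h1 | h1
    · obtain ⟨h2, h3⟩ := hY y h1
      have h4 : y ^ (-(1 - α)) * y = y ^ α := by
        rw [← Real.rpow_add_one h3.ne']; congr 1; ring
      linarith [Real.rpow_nonneg hZ0 α, mul_le_mul_of_nonneg_right h2 hy]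
    · have h2 := Real.rpow_le_rpow hy (h1.trans (le_max_left Y 0)) hα0
      have : 0 ≤ ε / (2 * g) * y := by positivity
      linarith
  have hderiv : ∀ x : ℝ, |deriv V x| ≤ ε / 2 * (1 + |x|) + g * Z ^ α := by
    intro x
    have hy : 0 ≤ 1 + |x| := by positivity
    have h1 : (1 + |x| ^ 2) ^ (α / 2) ≤ (1 + |x|) ^ α := by
      have : (1 + |x|) ^ α = ((1 + |x|) ^ 2) ^ (α / 2) := by
        rw [← Real.rpow_natCast, ← Real.rpow_mul hy]
        congr 1
        push_cast
        ring
      rw [this]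
      refine Real.rpow_le_rpow (by positivity) ?_ (by positivity)
      nlinarith [abs_nonneg x]
    have h2 := mul_le_mul_of_nonneg_left (h1.trans (hpow _ hy)) hg.le
    refine (h x).trans (h2.trans_eq ?_)
    field_simp
  set B := ε / 2 + g * Z ^ α with hB
  have hB0 : 0 ≤ B := by
    have := Real.rpow_nonneg hZ0 α
    positivity
  have hVx : ∀ x, |V x| ≤ |V 0| + (ε / 2 * |x| + B) * |x| := by
    intro x
    have := Convex.norm_image_sub_le_of_norm_deriv_le (f := V) (s := Set.Icc (-|x|) |x|) (x := 0)
      (y := x) (C := ε / 2 * |x| + B) (fun y _ => hV y) (fun y hy => by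
        rw [Real.norm_eq_abs]
        have h1 : |y| ≤ |x| := abs_le.2 hy
        have h2 := hderiv y
        rw [hB]
        nlinarith) (convex_Icc _ _) ⟨by simp, by simp⟩ ⟨neg_abs_le x, le_abs_self x⟩
    rw [sub_zero, Real.norm_eq_abs, Real.norm_eq_abs] at this
    have h3 := abs_sub_abs_le_abs_sub (V x) (V 0)
    linarith
  refine ⟨|V 0| + B ^ 2 / (2 * ε), by positivity, fun x => (hVx x).trans ?_⟩
  have h1 : ε / 2 * |x| ^ 2 + B ^ 2 / (2 * ε) - B * |x| = (ε * |x| - B) ^ 2 / (2 * ε) := by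
    field_simp
    ring
  have h2 : 0 ≤ (ε * |x| - B) ^ 2 / (2 * ε) := by positivity
  nlinarith [sq_abs x]

/-! ### The generator -/

/-- On `Dom N` the terms `pq + qp` and `V` impose no further condition, so `p²` and `q²` alone
determine the natural domain. -/
theorem generator_eq (ω γ Dpp Dpq Dqq : ℝ) {V : ℝ → ℝ} (h : domN ≤ (mulOp V).domain) :
    generator ω γ Dpp Dpq Dqq V = domOp (quadDom (-((Dqq : ℂ) + I / 2))
      (-((Dpp : ℂ) + I * (ω : ℂ) ^ 2 / 2)) ((Dpq : ℂ) - I * (γ : ℂ) / 2)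
      (((γ : ℂ) / 2) • domN.subtype + (-I) • domMul V h)) := by
  refine LinearPMap.ext (le_antisymm (fun u hu => ⟨hu.1.1.1, trivial⟩) fun u hu =>
    ⟨⟨⟨⟨domN_le_pSq hu, domN_le_qSq hu⟩, domN_le_pqqp hu⟩, trivial⟩, h hu⟩) fun u hu hu' => ?_
  exact add_assoc _ _ _

theorem quadX_expr_eq (r s : ℝ) :
    (r : ℂ) • pSq + pqqp + (s : ℂ) • qSq = domOp (quadDom r s 1 0) := by
  refine LinearPMap.ext (le_antisymm (fun u hu => ⟨⟨hu.1.1, hu.2⟩, trivial⟩) fun u hu =>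
    ⟨⟨domN_le_pSq hu, domN_le_pqqp hu⟩, domN_le_qSq hu⟩) fun u hu hu' => ?_
  change (r : ℂ) • domP2 ⟨u, hu'⟩ + domPQ ⟨u, hu'⟩ + (s : ℂ) • domQ2 ⟨u, hu'⟩
    = (r : ℂ) • domP2 ⟨u, hu'⟩ + (s : ℂ) • domQ2 ⟨u, hu'⟩ + (1 : ℂ) • domPQ ⟨u, hu'⟩ + 0
  rw [one_smul, add_zero]
  abel

theorem quadX_eq {r s : ℝ} (hr : 0 < r) (hrs : 1 < r * s) :
    quadX r s = domOp (quadDom r s 1 0) := by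
  rw [quadX, quadX_expr_eq]
  exact closure_domRestrict_domOp (isClosed_domOp_quadDom (κ := 1) (by simpa using hr)
    (by simpa using hrs) isSmall_zero isSmall_zero fun u v => by simp)

/-- The Lindblad condition makes a rotation of the quadratic part of the generator elliptic. -/
theorem exists_rotation_elliptic {ω γ Dpp Dpq Dqq : ℝ} (hω : 0 < ω) (hDqq : 0 ≤ Dqq)
    (hL : 0 ≤ Dpp * Dqq - Dpq ^ 2 - γ ^ 2 / 4) :
    ∃ κ : ℂ, 0 < (κ * (-((Dqq : ℂ) + I / 2))).re ∧
      (κ * ((Dpq : ℂ) - I * (γ : ℂ) / 2)).re ^ 2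
        < (κ * (-((Dqq : ℂ) + I / 2))).re * (κ * (-((Dpp : ℂ) + I * (ω : ℂ) ^ 2 / 2))).re := by
  have e1 : -((Dqq : ℂ) + I / 2) = ⟨-Dqq, -(1 / 2)⟩ := by
    apply Complex.ext <;> simp
  have e2 : -((Dpp : ℂ) + I * (ω : ℂ) ^ 2 / 2) = ⟨-Dpp, -(ω ^ 2 / 2)⟩ := by
    apply Complex.ext <;> simp [← ofReal_pow]
  have e3 : (Dpq : ℂ) - I * (γ : ℂ) / 2 = ⟨Dpq, -(γ / 2)⟩ := by
    apply Complex.ext <;> simp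
  rw [e1, e2, e3]
  -- For `γ = 0` the factor `i` selects the Hamiltonian form `p²/2 + ω²q²/2`, with no cross term.
  -- Otherwise `Dpp * Dqq - Dpq² ≥ γ²/4 > 0`, so the dissipative form is definite and the sign
  -- change `-1` suffices.
  by_cases hγ : γ = 0
  · refine ⟨I, by simp, ?_⟩
    simp [hγ]
    positivity
  · have hγ2 : 0 < γ ^ 2 := by positivity
    have hD : 0 < Dqq := hDqq.lt_of_ne fun h0 => by
      rw [← h0] at hL
      nlinarith [sq_nonneg Dpq]
    refine ⟨-1, by simpa using hD, ?_⟩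
    simp
    nlinarith

end QFP

end

theorem mainTheorem6
    (ω γ Dpp Dpq Dqq : ℝ) (hω : 0 < ω) (hDpp : 0 ≤ Dpp) (hDqq : 0 ≤ Dqq)
    (hLindblad : 0 ≤ Dpp * Dqq - Dpq ^ 2 - γ ^ 2 / 4)
    (V : ℝ → ℝ) (hV : Differentiable ℝ V) (hV' : Differentiable ℝ (deriv V))
    (gV α : ℝ) (hgV : 0 < gV) (hα0 : 0 ≤ α) (hα1 : α < 1)
    (hgrowth : ∀ x : ℝ, |deriv V x| ≤ gV * (1 + |x| ^ 2) ^ (α / 2)) :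
    -- the expression for `G` defines a densely defined, closable operator on `Dom N`
    Dense (QFP.numberOp.domain : Set QFP.H) ∧
    (QFP.generator ω γ Dpp Dpq Dqq V).domain = QFP.numberOp.domain ∧
    (QFP.generator ω γ Dpp Dpq Dqq V).IsClosable ∧
    -- the domains of `N`, of the closed operator `G`, and of `G*` coincide
    (QFP.generator ω γ Dpp Dpq Dqq V).closure.domain = QFP.numberOp.domain ∧
    ((QFP.generator ω γ Dpp Dpq Dqq V).closure†).domain = QFP.numberOp.domain ∧
    -- the graph norms of `N`, `G`, `G*` are equivalent
    QFP.EquivGraphNorms QFP.numberOp (QFP.generator ω γ Dpp Dpq Dqq V).closure ∧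
    QFP.EquivGraphNorms QFP.numberOp ((QFP.generator ω γ Dpp Dpq Dqq V).closure†) ∧
    -- the graph norms of `G` and `X` are equivalent, and `G` is relatively bounded by `X`
    ∀ r s : ℝ, 0 < r → 0 < s → 1 < r * s →
      QFP.EquivGraphNorms (QFP.quadX r s) (QFP.generator ω γ Dpp Dpq Dqq V).closure ∧
      QFP.RelativelyBounded (QFP.generator ω γ Dpp Dpq Dqq V).closure (QFP.quadX r s) := by
  obtain ⟨κ, ha, hc⟩ := QFP.exists_rotation_elliptic hω hDqq hLindblad
  have hVb : ∀ ε : ℝ, 0 < ε → ∃ C : ℝ, 0 ≤ C ∧ ∀ x, |V x| ≤ ε * x ^ 2 + C := fun ε hε =>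
    QFP.exists_abs_le_of_deriv_growth hV hgV hα0 hα1 hgrowth hε
  obtain ⟨C₀, -, hC₀⟩ := hVb 1 one_pos
  have hdom := QFP.domN_le_mulOp hV.continuous hC₀
  have hsV := QFP.isSmall_domMul hdom hVb
  rw [QFP.generator_eq ω γ Dpp Dpq Dqq hdom]
  set a : ℂ := -((Dqq : ℂ) + Complex.I / 2)
  set b : ℂ := -((Dpp : ℂ) + Complex.I * (ω : ℂ) ^ 2 / 2)
  set c : ℂ := (Dpq : ℂ) - Complex.I * (γ : ℂ) / 2
  set W := ((γ : ℂ) / 2) • QFP.domN.subtype + (-Complex.I) • QFP.domMul V hdom with hWdef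
  -- The formal adjoint of `W`: as `V` is real, only the sign of `i` changes.
  set W' := ((γ : ℂ) / 2) • QFP.domN.subtype + Complex.I • QFP.domMul V hdom with hWdef'
  have hW : QFP.IsSmall W := (QFP.isSmall_subtype.smul _).add (hsV.smul _)
  have hW' : QFP.IsSmall W' := (QFP.isSmall_subtype.smul _).add (hsV.smul _)
  have hWW' : ∀ u v : QFP.domN, inner ℂ (W' u) (v : QFP.H) = inner ℂ (u : QFP.H) (W v) := by
    intro u v
    have h : inner ℂ (QFP.domMul V hdom u) (v : QFP.H)
        = inner ℂ (u : QFP.H) (QFP.domMul V hdom v) := QFP.mulOp_symm V ⟨u, hdom u.2⟩ ⟨v, hdom v.2⟩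
    simp [hWdef, hWdef', inner_add_left, inner_add_right, inner_smul_left, inner_smul_right, h]
    exact Or.inl (by rw [map_ofNat])
  have hclosed := QFP.isClosed_domOp_quadDom ha hc hW hW' hWW'
  have hG : QFP.EquivHarmonic (QFP.quadDom a b c W) := QFP.equivHarmonic_quadDom ha hc hW
  have hG' : QFP.EquivHarmonic (QFP.quadDom (starRingEnd ℂ a) (starRingEnd ℂ b) (starRingEnd ℂ c) W') :=
    QFP.equivHarmonic_quadDom (κ := star κ) (by rwa [QFP.re_star_mul_conj])
      (by simpa only [QFP.re_star_mul_conj]) hW'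
  rw [QFP.closure_eq_self_of_isClosed hclosed, QFP.adjoint_domOp_quadDom ha hc hW hW' hWW',
    QFP.numberOp_eq]
  refine ⟨QFP.dense_domN, rfl, hclosed.isClosable, rfl, rfl,
    QFP.equivHarmonic_number.equivGraphNorms hG, QFP.equivHarmonic_number.equivGraphNorms hG',
    fun r s hr hs hrs => ?_⟩
  rw [QFP.quadX_eq hr hrs]
  have hX : QFP.EquivHarmonic (QFP.quadDom r s 1 0) :=
    QFP.equivHarmonic_quadDom (κ := 1) (by simpa using hr) (by simpa using hrs) QFP.isSmall_zero
  exact ⟨hX.equivGraphNorms hG, hG.relativelyBounded hX⟩
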